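/- Chain complexes are $\mathbb{Z}$-graded complexes of abelian groups with differential of degree $-1$; dg-categories are categories enriched in them, $\mathrm{Ch}$ is the dg-category of chain complexes with homogeneous linear maps of all degrees, and composition is written in diagrammatic order ($f\cdot g$ means first $f$, then $g$). A *prop* is a strict symmetric monoidal dg-category whose objects are the natural numbers, with $a\otimes b=a+b$. A *prop with $A_\infty$-multiplication* is a prop $\mathcal{E}$ with a symmetric monoidal dg-functor $i:\mathcal{A}_\infty\to\mathcal{E}$, identity on objects; here $\mathcal{A}_\infty$ is the prop generated by morphisms $m_s:s\to 1$ of degree $s-2$ ($s\ge 2$) with $$d\,m_n=\sum_{a+s+b=n,\ 2\le s<n}(-1)^{a+s+as}\,(\mathrm{id}_a\otimes m_s\otimes \mathrm{id}_b)\cdot m_{a+1+b},$$ so $i$ amounts to a choice of such $m_s\in\mathcal{E}(s,1)$. For $1\le k<n$ let $f_{n,k}\in\mathcal{E}(n,k)$ be the element of degree $n-k-1$ $$f_{n,k}=-\sum_{a=0}^{k-1}(-1)^{a(n-k)}\,\mathrm{id}_a\otimes m_{n-k+1}\otimes\mathrm{id}_{k-1-a}\;-\;\sum_{j=k}^{n-1}(-1)^{j(n-j)}\,\sigma_{j,n-j}\cdot(m_{n-k+1}\otimes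 \mathrm{id}_{k-1}),$$ where $\sigma_{j,n-j}:j+(n-j)\to(n-j)+j$ is the symmetry: it multiplies $n-k+1$ cyclically consecutive entries in all possible ways. The *Hochschild complex* of a dg-functor $\Phi:\mathcal{E}\to\mathrm{Ch}$ is the dg-functor $C(\Phi):\mathcal{E}\to\mathrm{Ch}$ with $$C(\Phi)(m)=\bigoplus_{n\ge 1}\Phi(n+m)\otimes \mathbb{Z}l_n,\quad |l_n|=n-1,\qquad d(x\otimes l_n)=dx\otimes l_n+(-1)^{|x|}\sum_{1\le k<n}\Phi(f_{n,k}\otimes \mathrm{id}_m)(x)\otimes l_k,$$ on which $g\in\mathcal{E}(m,m')$ acts by $x\otimes l_n\mapsto(-1)^{(n-1)|g|}\Phi(\mathrm{id}_n\otimes g)(x)\otimes l_n$. Let $C^n$ be its $n$-fold iterate. For $n,m\ge 0$ let $C_{\mathcal{E}}^{(n,m)}:\mathrm{Fun}(\mathcal{E},\mathrm{Ch})\to\mathrm{Ch}$ be the dg-functor $\Phi\mapsto C^n(\Phi)(m)$, where $\mathrm{Fun}(\mathcal{E},\mathrm{Ch})$ is the dg-category of dg-functors and natural transformations of all degrees.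 The dg-category $\mathrm{Nat}_{\mathcal{E}}$ of formal operations has as objects the pairs $(n,m)$ of natural numbers, and as morphism complex from $(n_1,m_1)$ to $(n_2,m_2)$ the complex $\mathrm{Hom}(C_{\mathcal{E}}^{(n_1,m_1)},C_{\mathcal{E}}^{(n_2,m_2)})$ of natural transformations of dg-functors. Let $\mathcal{E}$ and $\mathcal{E}'$ be props with $A_\infty$-multiplication, and let $\varphi:\mathcal{E}\to\mathcal{E}'$ be a dg-functor, compatible with the functors from $\mathcal{A}_\infty$ (that is, $\varphi\circ i=i'$), which is a quasi-isomorphism of categories: it is the identity on objects and a quasi-isomorphism on every morphism complex. For dg-functors $\Phi':\mathcal{E}'\to\mathrm{Ch}$ one has $C_{\mathcal{E}}^{(n,m)}(\varphi^*\Phi')=C_{\mathcal{E}'}^{(n,m)}(\Phi')$, so that $\nu\mapsto(\nu_{\varphi^*\Phi'})_{\Phi'}$ defines a dg-functor $\mathrm{Nat}_{\mathcal{E}}\to\mathrm{Nat}_{\mathcal{E}'}$ which is the identity on objects. **Claim.** This dg-functor $\mathrm{Nat}_{\mathcal{E}}\to\mathrm{Nat}_{\mathcal{E}'}$ is a quasi-isomorphism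 of categories: for all $n_1,m_1,n_2,m_2\ge 0$ the induced chain map $$\mathrm{Hom}(C_{\mathcal{E}}^{(n_1,m_1)},C_{\mathcal{E}}^{(n_2,m_2)})\longrightarrow\mathrm{Hom}(C_{\mathcal{E}'}^{(n_1,m_1)},C_{\mathcal{E}'}^{(n_2,m_2)})$$ is a quasi-isomorphism. -/

import Mathlib

open CategoryTheory

universe u v w

/-- The sign `(-1)^p` as an integer. -/
def sgn (p : ℤ) : ℤ := (p.negOnePow : ℤ)

lemma sgn_add (p q : ℤ) : sgn (p + q) = sgn p * sgn q := by
  simp [sgn, Int.negOnePow_add]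

lemma sgn_zero : sgn 0 = 1 := by simp [sgn]

lemma sgn_one : sgn 1 = -1 := by simp [sgn]

lemma sgn_congr {p q : ℤ} (h : Even (p - q)) : sgn p = sgn q := by
  have : p.negOnePow = q.negOnePow := (Int.negOnePow_eq_iff p q).2 h
  simp [sgn, this]

lemma sgn_mul_self (p : ℤ) : sgn p * sgn p = 1 := by
  rw [← sgn_add, ← sgn_zero]; exact sgn_congr ⟨p, by ring⟩

/-- A dg-category with set of objects `O`: a category enriched in chain complexes of
`ℤ`-modules. Composition is written in diagrammatic order, and is a chain map
`hom a b ⊗ hom b c ⟶ hom a c`. -/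
structure DGCat (O : Type w) where
  hom : O → O → ChainComplex AddCommGrpCat.{v} ℤ
  comp {a b c : O} {p q r : ℤ} (h : p + q = r) :
    (hom a b).X p →+ (hom b c).X q →+ (hom a c).X r
  id (a : O) : (hom a a).X 0
  id_comp {a b : O} {p : ℤ} (f : (hom a b).X p) : comp (zero_add p) (id a) f = f
  comp_id {a b : O} {p : ℤ} (f : (hom a b).X p) : comp (add_zero p) f (id b) = f
  assoc {a b c e : O} {p q r pq qr s : ℤ} (h₁ : p + q = pq) (h₂ : pq + r = s)
    (h₃ : q + r = qr) (h₄ : p + qr = s)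
    (f : (hom a b).X p) (g : (hom b c).X q) (k : (hom c e).X r) :
    comp h₂ (comp h₁ f g) k = comp h₄ f (comp h₃ g k)
  d_comp {a b c : O} {p q r p' q' r' : ℤ} (h : p + q = r)
    (hp : p' + 1 = p) (hq : q' + 1 = q) (hr : r' + 1 = r)
    (f : (hom a b).X p) (g : (hom b c).X q) :
    (hom a c).d r r' (comp h f g) =
      comp (by omega) ((hom a b).d p p' f) g
        + sgn p • comp (by omega) f ((hom b c).d q q' g)

/-- A dg-functor that is the identity on objects. -/
structure DGCat.Functor {O : Type w} (A B : DGCat.{v} O) where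
  map (a b : O) : A.hom a b ⟶ B.hom a b
  map_id (a : O) : (map a a).f 0 (A.id a) = B.id a
  map_comp {a b c : O} {p q r : ℤ} (h : p + q = r)
    (f : (A.hom a b).X p) (g : (A.hom b c).X q) :
    (map a c).f r (A.comp h f g) = B.comp h ((map a b).f p f) ((map b c).f q g)

/-- A quasi-isomorphism of dg-categories: a dg-functor which is the identity on objects and
a quasi-isomorphism on each morphism complex. -/
def DGCat.Functor.IsQuasiIso {O : Type w} {A B : DGCat.{v} O} (F : A.Functor B) : Prop :=
  ∀ a b : O, _root_.QuasiIso (F.map a b)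

/-- A prop in chain complexes: a strict symmetric monoidal dg-category whose objects are the
natural numbers, with tensor product of objects given by addition. The tensor product
`tens` of morphisms is a chain map, `braid` is the symmetry `a + b ⟶ b + a`; equalities
between natural numbers are carried as hypotheses. -/
structure DGProp extends DGCat.{u} ℕ where
  tens {a b a' b' c e : ℕ} {p q r : ℤ} (hs : a + a' = c) (ht : b + b' = e) (h : p + q = r) :
    (hom a b).X p →+ (hom a' b').X q →+ (hom c e).X r
  id_tens_id {a b c : ℕ} (h : a + b = c) : tens h h (add_zero 0) (id a) (id b) = id c
  tens_comp_tens {a₁ b₁ c₁ a₂ b₂ c₂ a b c : ℕ} {p₁ p₂ q₁ q₂ p q r₁ r₂ r : ℤ}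
    (ha : a₁ + a₂ = a) (hb : b₁ + b₂ = b) (hc : c₁ + c₂ = c)
    (hp : p₁ + p₂ = p) (hq : q₁ + q₂ = q) (h₁ : p₁ + q₁ = r₁) (h₂ : p₂ + q₂ = r₂)
    (h : p + q = r) (h' : r₁ + r₂ = r)
    (f₁ : (hom a₁ b₁).X p₁) (f₂ : (hom a₂ b₂).X p₂)
    (g₁ : (hom b₁ c₁).X q₁) (g₂ : (hom b₂ c₂).X q₂) :
    comp h (tens ha hb hp f₁ f₂) (tens hb hc hq g₁ g₂) =
      sgn (p₂ * q₁) • tens ha hc h' (comp h₁ f₁ g₁) (comp h₂ f₂ g₂)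
  tens_assoc {a₁ b₁ a₂ b₂ a₃ b₃ a₁₂ b₁₂ a₂₃ b₂₃ a b : ℕ} {p₁ p₂ p₃ p₁₂ p₂₃ p : ℤ}
    (ha₁₂ : a₁ + a₂ = a₁₂) (hb₁₂ : b₁ + b₂ = b₁₂) (hp₁₂ : p₁ + p₂ = p₁₂)
    (ha₂₃ : a₂ + a₃ = a₂₃) (hb₂₃ : b₂ + b₃ = b₂₃) (hp₂₃ : p₂ + p₃ = p₂₃)
    (ha : a₁₂ + a₃ = a) (hb : b₁₂ + b₃ = b) (hp : p₁₂ + p₃ = p)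
    (ha' : a₁ + a₂₃ = a) (hb' : b₁ + b₂₃ = b) (hp' : p₁ + p₂₃ = p)
    (f₁ : (hom a₁ b₁).X p₁) (f₂ : (hom a₂ b₂).X p₂) (f₃ : (hom a₃ b₃).X p₃) :
    tens ha hb hp (tens ha₁₂ hb₁₂ hp₁₂ f₁ f₂) f₃ =
      tens ha' hb' hp' f₁ (tens ha₂₃ hb₂₃ hp₂₃ f₂ f₃)
  id_zero_tens {a b : ℕ} {p : ℤ} (f : (hom a b).X p) :
    tens (zero_add a) (zero_add b) (zero_add p) (id 0) f = f
  tens_id_zero {a b : ℕ} {p : ℤ} (f : (hom a b).X p) :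
    tens (add_zero a) (add_zero b) (add_zero p) f (id 0) = f
  d_tens {a b a' b' c e : ℕ} {p q r p' q' r' : ℤ} (hs : a + a' = c) (ht : b + b' = e)
    (h : p + q = r) (hp : p' + 1 = p) (hq : q' + 1 = q) (hr : r' + 1 = r)
    (f : (hom a b).X p) (g : (hom a' b').X q) :
    (hom c e).d r r' (tens hs ht h f g) =
      tens hs ht (by omega) ((hom a b).d p p' f) g
        + sgn p • tens hs ht (by omega) f ((hom a' b').d q q' g)
  braid (a b : ℕ) {c c' : ℕ} (h : a + b = c) (h' : b + a = c') : (hom c c').X 0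
  d_braid {a b c c' : ℕ} (h : a + b = c) (h' : b + a = c') :
    (hom c c').d 0 (-1) (braid a b h h') = 0
  tens_braid {a b a' b' c e c' e' : ℕ} {p q r : ℤ} (hs : a + a' = c) (ht : b + b' = e)
    (hs' : a' + a = c') (ht' : b' + b = e') (h : p + q = r) (h' : q + p = r)
    (f : (hom a b).X p) (g : (hom a' b').X q) :
    comp (add_zero r) (tens hs ht h f g) (braid b b' ht ht') =
      sgn (p * q) • comp (zero_add r) (braid a a' hs hs') (tens hs' ht' h' g f)
  braid_braid {a b c c' : ℕ} (h : a + b = c) (h' : b + a = c') :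
    comp (add_zero 0) (braid a b h h') (braid b a h' h) = id c
  braid_add {a b c ab bc cb ac ca n n' n'' : ℕ} (hab : a + b = ab) (hbc : b + c = bc)
    (hcb : c + b = cb) (hac : a + c = ac) (hca : c + a = ca) (hn : ab + c = n)
    (hn₁ : a + bc = n) (hn₂ : a + cb = n') (hn₃ : ac + b = n') (hn₄ : ca + b = n'')
    (hn'' : c + ab = n'') :
    braid ab c hn hn'' =
      comp (add_zero 0) (tens hn₁ hn₂ (add_zero 0) (id a) (braid b c hbc hcb))
        (tens hn₃ hn₄ (add_zero 0) (braid a c hac hca) (id b))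

namespace DGProp

variable (E : DGProp.{u})

/-- `id_a ⊗ f ⊗ id_b`. -/
def win (a b : ℕ) {s t n m : ℕ} {p : ℤ} (hn : a + s + b = n) (hm : a + t + b = m) :
    (E.hom s t).X p →+ (E.hom n m).X p :=
  ((E.tens hn hm (add_zero p)).flip (E.id b)).comp (E.tens rfl rfl (zero_add p) (E.id a))

variable {E}

lemma win_apply (a b : ℕ) {s t n m : ℕ} {p : ℤ} (hn : a + s + b = n) (hm : a + t + b = m)
    (f : (E.hom s t).X p) :
    E.win a b hn hm f =
      E.tens hn hm (add_zero p) (E.tens rfl rfl (zero_add p) (E.id a) f) (E.id b) := rfl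

lemma d_id {q : ℤ} (a : ℕ) (hq : q + 1 = 0) : (E.hom a a).d 0 q (E.id a) = 0 := by
  have h := E.d_comp (add_zero 0) hq hq hq (E.id a) (E.id a)
  rw [E.comp_id, E.comp_id, E.id_comp, sgn_zero, one_smul] at h
  simpa using h

lemma d_win (a b : ℕ) {s t n m : ℕ} {p q : ℤ} (hn : a + s + b = n) (hm : a + t + b = m)
    (hq : q + 1 = p) (f : (E.hom s t).X p) :
    (E.hom n m).d p q (E.win a b hn hm f) = E.win a b hn hm ((E.hom s t).d p q f) := by
  have h0 : (-1 : ℤ) + 1 = 0 := by norm_num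
  rw [win_apply, E.d_tens hn hm _ hq h0 hq, E.d_tens rfl rfl _ h0 hq hq, d_id a h0, d_id b h0]
  simp [sgn_zero, win_apply]

lemma comp_win (a b : ℕ) {s t k n m l : ℕ} {p q r : ℤ} (h : p + q = r)
    (hn : a + s + b = n) (hm : a + t + b = m) (hl : a + k + b = l)
    (f : (E.hom s t).X p) (g : (E.hom t k).X q) :
    E.comp h (E.win a b hn hm f) (E.win a b hm hl g) = E.win a b hn hl (E.comp h f g) := by
  rw [win_apply, win_apply, win_apply,
    E.tens_comp_tens hn hm hl _ _ h (add_zero 0) h (add_zero r),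
    E.tens_comp_tens rfl rfl rfl _ _ (add_zero 0) h h (zero_add r)]
  simp [sgn_zero, E.comp_id]

lemma win_id (a b : ℕ) {s n : ℕ} (hn : a + s + b = n) : E.win a b hn hn (E.id s) = E.id n := by
  rw [win_apply, E.id_tens_id, E.id_tens_id]

lemma win_zero_zero {s t : ℕ} {p : ℤ} (hn : 0 + s + 0 = s) (hm : 0 + t + 0 = t)
    (f : (E.hom s t).X p) : E.win 0 0 hn hm f = f := by
  have : ∀ {s' t' : ℕ} (h1 : 0 + s = s') (h2 : 0 + t = t') (h3 : s' = s) (h4 : t' = t)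
    (hn : s' + 0 = s) (hm : t' + 0 = t),
      E.tens hn hm (add_zero p) (E.tens h1 h2 (zero_add p) (E.id 0) f) (E.id 0) = f := by
    rintro s' t' h1 h2 rfl rfl hn hm
    rw [E.tens_id_zero, E.id_zero_tens]
  exact this _ _ (by omega) (by omega) _ _

lemma win_eq (a b : ℕ) {s t n m sb tb : ℕ} {p : ℤ} (hn : a + s + b = n) (hm : a + t + b = m)
    (hsb : s + b = sb) (htb : t + b = tb) (hn' : a + sb = n) (hm' : a + tb = m)
    (f : (E.hom s t).X p) :
    E.win a b hn hm f =
      E.tens hn' hm' (zero_add p) (E.id a) (E.tens hsb htb (add_zero p) f (E.id b)) := by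
  rw [win_apply]; exact E.tens_assoc ..

lemma win_win (a b a' b' : ℕ) {s t n m n' m' a'' b'' : ℕ} {p : ℤ} (hn : a + s + b = n)
    (hm : a + t + b = m) (hn' : a' + n + b' = n') (hm' : a' + m + b' = m')
    (ha : a' + a = a'') (hb : b + b' = b'') (hn'' : a'' + s + b'' = n') (hm'' : a'' + t + b'' = m')
    (f : (E.hom s t).X p) :
    E.win a' b' hn' hm' (E.win a b hn hm f) = E.win a'' b'' hn'' hm'' f := by
  rw [win_apply a' b', win_apply a b,
    ← E.tens_assoc (p₁₂ := p) (a₁₂ := a'' + s) (b₁₂ := a'' + t) (by omega) (by omega)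
      (zero_add p) hn hm (add_zero p) (by omega) (by omega) (add_zero p),
    ← E.tens_assoc (p₁₂ := 0) (a₁₂ := a'') (b₁₂ := a'') ha ha (add_zero 0) rfl rfl
      (zero_add p) rfl rfl (zero_add p), E.id_tens_id,
    E.tens_assoc (p₂₃ := 0) (a₂₃ := b'') (b₂₃ := b'') _ _ _ hb hb (add_zero 0)
      hn' hm' (add_zero p) hn'' hm'' (add_zero p), E.id_tens_id, win_apply]

/-- Operations on disjoint blocks commute up to the Koszul sign. -/
lemma win_disj (a b c : ℕ) {s t s' t' n k k' m bl bl' br br' : ℕ} {p q r : ℤ}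
    (hbl : a + s + b = bl) (hbl' : a + t + b = bl') (hbr : b + s' + c = br)
    (hbr' : b + t' + c = br')
    (h : p + q = r) (h' : q + p = r)
    (h1 : a + s + br = n) (h2 : a + t + br = k) (h3 : bl' + s' + c = k) (h4 : bl' + t' + c = m)
    (h5 : bl + s' + c = n) (h6 : bl + t' + c = k') (h7 : a + s + br' = k') (h8 : a + t + br' = m)
    (f : (E.hom s t).X p) (g : (E.hom s' t').X q) :
    E.comp h (E.win a br h1 h2 f) (E.win bl' c h3 h4 g) =
      sgn (p * q) • E.comp h' (E.win bl c h5 h6 g) (E.win a br' h7 h8 f) := by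
  -- write `f = f ⊗ id`, `g = id ⊗ g` over the splitting `(a + s) + br`
  have e1 : E.win bl' c h3 h4 g = E.tens (a := a + t) (b := a + t) (a' := br) (b' := br') h2 h8
      (zero_add q) (E.id (a + t)) (E.win b c hbr hbr' g) := by
    have := win_win (E := E) b c (a + t) 0 hbr hbr' (n' := k) (m' := m) (by omega) (by omega)
      (a'' := bl') (b'' := c) (by omega) (by omega) h3 h4 g
    rw [← this, win_eq (a + t) 0 _ _ (add_zero _) (add_zero _) h2 h8, E.tens_id_zero]
  have e2 : E.win bl c h5 h6 g = E.tens (a := a + s) (b := a + s) (a' := br) (b' := br') h1 h7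
      (zero_add q) (E.id (a + s)) (E.win b c hbr hbr' g) := by
    have := win_win (E := E) b c (a + s) 0 hbr hbr' (n' := n) (m' := k') (by omega) (by omega)
      (a'' := bl) (b'' := c) (by omega) (by omega) h5 h6 g
    rw [← this, win_eq (a + s) 0 _ _ (add_zero _) (add_zero _) h1 h7, E.tens_id_zero]
  rw [e1, e2, win_apply, E.tens_comp_tens h1 h2 h8 _ _ (add_zero p) (zero_add q) h h,
    win_apply a br' h7 h8 f, E.tens_comp_tens h1 h7 h8 _ _ (zero_add p) (add_zero q) h' h]
  simp only [E.comp_id, E.id_comp, smul_smul]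
  rw [← sgn_add, mul_zero, sgn_zero, one_smul]
  have : p * q + q * p = p * q + p * q := by ring
  rw [this, sgn_add, sgn_mul_self, one_smul]

lemma win_braid_left (a b c : ℕ) {s t n m n' m' bc x y ca : ℕ} {p : ℤ}
    (hbc : b + c = bc) (hca : c + a = ca)
    (hx : a + s + b = x) (hy : a + t + b = y)
    (hn : a + s + bc = n) (hm : a + t + bc = m) (hb : y + c = m) (hb' : c + y = m')
    (hd : x + c = n) (hd' : c + x = n') (hn' : ca + s + b = n') (hm' : ca + t + b = m')
    (f : (E.hom s t).X p) :
    E.comp (add_zero p) (E.win a bc hn hm f) (E.braid y c hb hb') =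
      E.comp (zero_add p) (E.braid x c hd hd') (E.win ca b hn' hm' f) := by
  have e1 : E.win a bc hn hm f = E.tens hd hb (add_zero p) (E.win a b hx hy f) (E.id c) := by
    rw [← win_win (E := E) a b 0 c hx hy (by omega) (by omega) (zero_add a) hbc hn hm f,
      win_eq 0 c _ _ hd hb (zero_add _) (zero_add _), E.id_zero_tens]
  have e2 : E.win ca b hn' hm' f = E.tens hd' hb' (zero_add p) (E.id c) (E.win a b hx hy f) := by
    rw [← win_win (E := E) a b c 0 hx hy (by omega) (by omega) hca (add_zero b) hn' hm' f,
      win_eq c 0 _ _ (add_zero _) (add_zero _) hd' hb', E.tens_id_zero]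
  rw [e1, e2, E.tens_braid hd hb hd' hb' (add_zero p) (zero_add p), mul_zero, sgn_zero, one_smul]

lemma win_braid_right (a b c : ℕ) {s t n m n' m' bc x y ca : ℕ} {p : ℤ}
    (hbc : b + c = bc) (hca : c + a = ca)
    (hx : a + s + b = x) (hy : a + t + b = y)
    (hn : ca + s + b = n) (hm : ca + t + b = m) (hb : c + y = m) (hb' : y + c = m')
    (hd : c + x = n) (hd' : x + c = n') (hn' : a + s + bc = n') (hm' : a + t + bc = m')
    (f : (E.hom s t).X p) :
    E.comp (add_zero p) (E.win ca b hn hm f) (E.braid c y hb hb') =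
      E.comp (zero_add p) (E.braid c x hd hd') (E.win a bc hn' hm' f) := by
  have e1 : E.win a bc hn' hm' f = E.tens hd' hb' (add_zero p) (E.win a b hx hy f) (E.id c) := by
    rw [← win_win (E := E) a b 0 c hx hy (by omega) (by omega) (zero_add a) hbc hn' hm' f,
      win_eq 0 c _ _ hd' hb' (zero_add _) (zero_add _), E.id_zero_tens]
  have e2 : E.win ca b hn hm f = E.tens hd hb (zero_add p) (E.id c) (E.win a b hx hy f) := by
    rw [← win_win (E := E) a b c 0 hx hy (by omega) (by omega) hca (add_zero b) hn hm f,
      win_eq c 0 _ _ (add_zero _) (add_zero _) hd hb, E.tens_id_zero]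
  rw [e1, e2, E.tens_braid hd hb hd' hb' (zero_add p) (add_zero p), zero_mul, sgn_zero, one_smul]

lemma braid_cyc (a b c : ℕ) {ab ca bc n : ℕ} (hab : a + b = ab) (hca : c + a = ca)
    (hbc : b + c = bc) (h1 : ab + c = n) (h2 : c + ab = n) (h3 : ca + b = n) (h4 : b + ca = n)
    (h5 : a + bc = n) (h6 : bc + a = n) :
    E.comp (add_zero 0) (E.braid ab c h1 h2) (E.braid ca b h3 h4) = E.braid a bc h5 h6 := by
  have hx := E.braid_add (a := c) (b := a) (c := b) hca hab (by omega : b + a = ab)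
    (by omega : c + b = bc) hbc h3 h2 h2 (by omega : bc + a = n) (by omega : bc + a = n) h4
  have hy := E.braid_add (a := b) (b := a) (c := c) (by omega : b + a = ab) (by omega : a + c = ca)
    hca hbc (by omega : c + b = bc) h1 h4 h4 (by omega : bc + a = n) (by omega : bc + a = n) h2
  have hz := E.braid_add (a := b) (b := c) (c := a) hbc hca (by omega : a + c = ca)
    (by omega : b + a = ab) hab h6 h4 h4 h1 h1 h5
  have nat := E.tens_braid (a := ab) (b := ab) (a' := c) (b' := c) h1 h1 h2 h2 (add_zero 0)
    (add_zero 0) (E.braid a b hab (by omega)) (E.id c)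
  rw [zero_mul, sgn_zero, one_smul] at nat
  -- the claim after composing with the inverse of `braid a bc`
  have key : E.comp (add_zero 0) (E.braid ab c h1 h2) (E.braid ca b h3 h4) =
      E.comp (add_zero 0) (E.tens h1 h1 (add_zero 0) (E.braid a b hab (by omega)) (E.id c))
        (E.tens h4 h4 (add_zero 0) (E.id b) (E.braid a c (by omega) hca)) := by
    rw [hx, ← E.assoc (add_zero 0) (add_zero 0) (add_zero 0) (add_zero 0), ← nat, hy,
      E.assoc (add_zero 0) (add_zero 0) (add_zero 0) (add_zero 0),
      E.assoc (add_zero 0) (add_zero 0) (add_zero 0) (add_zero 0),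
      E.tens_comp_tens _ _ _ _ _ (add_zero 0) (add_zero 0) (add_zero 0) (add_zero 0),
      E.braid_braid, E.comp_id, E.id_tens_id, mul_zero, sgn_zero, one_smul, E.comp_id]
  have inv : E.comp (add_zero 0)
      (E.comp (add_zero 0) (E.braid ab c h1 h2) (E.braid ca b h3 h4)) (E.braid bc a h6 h5) =
        E.id n := by
    rw [key, hz, E.assoc (add_zero 0) (add_zero 0) (add_zero 0) (add_zero 0),
      ← E.assoc (add_zero 0) (add_zero 0) (add_zero 0) (add_zero 0) _ _
        (E.tens h1 h1 _ _ (E.id c)),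
      E.tens_comp_tens _ _ _ _ _ (add_zero 0) (add_zero 0) (add_zero 0) (add_zero 0),
      E.braid_braid, E.comp_id, E.id_tens_id, mul_zero, sgn_zero, one_smul, E.id_comp,
      E.tens_comp_tens _ _ _ _ _ (add_zero 0) (add_zero 0) (add_zero 0) (add_zero 0),
      E.braid_braid, E.comp_id, E.id_tens_id, mul_zero, sgn_zero, one_smul]
  have := congrArg (fun z => E.comp (add_zero 0) z (E.braid a bc h5 h6)) inv
  rw [E.assoc (add_zero 0) (add_zero 0) (add_zero 0) (add_zero 0) _ (E.braid bc a h6 h5),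
    E.braid_braid, E.comp_id, E.id_comp] at this
  exact this

end DGProp

/-- A prop with `A_∞`-multiplication: a prop with morphisms `m_s : s ⟶ 1` of degree `s - 2`
for `s ≥ 2`, satisfying the `A_∞`-relations
`d m_n = ∑ (-1)^(a + s + a s) (id_a ⊗ m_s ⊗ id_b) ≫ m_(a + 1 + b)`, the sum being over all
`a + s + b = n` with `2 ≤ s < n`. -/
structure AinfProp extends DGProp.{u} where
  mul (s : ℕ) (p : ℤ) (hs : 2 ≤ s) (hp : p + 2 = s) : (hom s 1).X p
  d_mul (n : ℕ) (p q : ℤ) (hn : 2 ≤ n) (hp : p + 2 = n) (hq : q + 1 = p) :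
    (hom n 1).d p q (mul n p hn hp) =
      ∑ s ∈ Finset.range n, ∑ a ∈ Finset.range n,
        if h : 2 ≤ s ∧ s < n ∧ a + s ≤ n then
          sgn (a + s + a * s) • comp (p := s - 2) (q := n - s - 1) (by omega)
            (toDGProp.win a (n - s - a) (by omega) rfl (mul s (s - 2) (by omega) (by omega)))
            (mul (a + 1 + (n - s - a)) (n - s - 1) (by omega) (by omega))
        else 0

namespace AinfProp

variable (E : AinfProp.{u})

/-- The morphism `n ⟶ k` applying the multiplication `m_(n-k+1)` to the entries
`a + 1, …, a + n - k + 1` (for `a < k < n`). -/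
def block (n k a : ℕ) : (E.hom n k).X ((n : ℤ) - k - 1) :=
  if h : k < n ∧ a < k then
    E.win a (k - 1 - a) (by omega) (by omega)
      (E.mul (n - k + 1) ((n : ℤ) - k - 1) (by omega) (by omega))
  else 0

/-- The morphism `n ⟶ k`, with its sign, applying `m_(n-k+1)` to the `n - k + 1` cyclically
consecutive entries that start at the entry `i + 1`. For `i < k` the entries do not wrap around
and the product is placed at position `i + 1`. For `k ≤ i < n` they are
`i + 1, …, n, 1, …, i + 1 - k`, and the product is placed at the first position. -/
def cyc (n k i : ℕ) : (E.hom n k).X ((n : ℤ) - k - 1) :=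
  if i < k then sgn (i * (n - k)) • E.block n k i
  else if h : i < n then
    sgn (i * (n - i)) • E.comp (zero_add _) (E.braid i (n - i) (by omega) (by omega))
      (E.block n k 0)
  else 0

/-- The morphisms `f_{n,k} : n ⟶ k` of the Hochschild differential `l_n ↦ ∑ f_{n,k} ⊗ l_k`. -/
def hochTerm (n k : ℕ) : (E.hom n k).X ((n : ℤ) - k - 1) :=
  - ∑ i ∈ Finset.range n, E.cyc n k i

variable {E}

lemma block_pos {n k a : ℕ} (h : k < n) (h' : a < k) {b s : ℕ} (hb : a + 1 + b = k)
    (hs : s + k = n + 1) :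
    E.block n k a = E.win a b (by omega) (by omega)
      (E.mul s ((n : ℤ) - k - 1) (by omega) (by omega)) := by
  obtain rfl : b = k - 1 - a := by omega
  obtain rfl : s = n - k + 1 := by omega
  simp [block, h, h']

lemma d_block {n j I : ℕ} {p : ℤ} (hp : p + 1 = n - j - 1) (h : j < n) (h' : I < j) :
    (E.hom n j).d ((n : ℤ) - j - 1) p (E.block n j I) =
      ∑ k ∈ Finset.Ioo j n, ∑ a ∈ Finset.range (k - j + 1),
        sgn (a + (n - k + 1) * (1 + a)) •
          E.comp (by omega) (E.block n k (I + a)) (E.block k j I) := by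
  rw [block_pos h h' (b := j - 1 - I) (s := n - j + 1) (by omega) (by omega),
    DGProp.d_win _ _ _ _ hp, E.d_mul _ _ _ _ _ hp, map_sum]
  simp only [map_sum]
  have e1 : Finset.Ico 2 (n - j + 1) ⊆ Finset.range (n - j + 1) := by
    intro x; simp
  rw [← Finset.sum_subset e1]
  · refine Finset.sum_nbij' (fun s => n + 1 - s) (fun k => n + 1 - k) ?_ ?_ ?_ ?_ ?_
    · intro s hs; simp only [Finset.mem_Ico, Finset.mem_Ioo] at hs ⊢; omega
    · intro s hs; simp only [Finset.mem_Ico, Finset.mem_Ioo] at hs ⊢; omega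
    · intro s hs; simp only [Finset.mem_Ico] at hs ⊢; omega
    · intro s hs; simp only [Finset.mem_Ioo] at hs ⊢; omega
    · intro s hs
      simp only [Finset.mem_Ico] at hs
      have e2 : Finset.range (n + 1 - s - j + 1) ⊆ Finset.range (n - j + 1) := by
        intro x; simp only [Finset.mem_range]; omega
      rw [← Finset.sum_subset e2]
      · refine Finset.sum_congr rfl fun a ha => ?_
        simp only [Finset.mem_range] at ha
        obtain ⟨k, hk⟩ : ∃ k, k = n + 1 - s := ⟨_, rfl⟩
        rw [dif_pos (by omega), ← hk, map_zsmul]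
        rw [block_pos (k := k) (b := j - 1 - I + (n - j + 1 - s - a)) (s := s)
            (by omega) (by omega) (by omega) (by omega),
          block_pos (n := k) (b := j - 1 - I) (s := a + 1 + (n - j + 1 - s - a)) (by omega)
            (by omega) (by omega) (by omega),
          ← DGProp.win_win (E := E.toDGProp) a (n - j + 1 - s - a) I (j - 1 - I) (n := n - j + 1)
            (m := a + 1 + (n - j + 1 - s - a)) (by omega) (by omega) (by omega) (by omega) rfl
            (by omega) (by omega) (by omega),
          DGProp.comp_win _ _ _ _ _ (by omega)]
        have hsg : sgn ((a : ℤ) + s + a * s) = sgn (a + (n - k + 1) * (1 + a)) := by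
          have : (s : ℤ) = n - k + 1 := by omega
          rw [this]; exact sgn_congr ⟨0, by ring⟩
        rw [hsg]
        congr 2
        have : ∀ (x y x' y' : ℤ) (h1 h2 h3 h4 h5 h6) (_ : x = x') (_ : y = y'),
            E.comp (p := x) (q := y) (r := p) h5
              (E.win a (n - j + 1 - s - a) (n := n - j + 1) (by omega) rfl (E.mul s x (by omega) h1))
              (E.mul (a + 1 + (n - j + 1 - s - a)) y (by omega) h2) =
            E.comp (p := x') (q := y') (r := p) h6
              (E.win a (n - j + 1 - s - a) (n := n - j + 1) (by omega) rfl (E.mul s x' (by omega) h3))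
              (E.mul (a + 1 + (n - j + 1 - s - a)) y' (by omega) h4) := by
          rintro x y x' y' h1 h2 h3 h4 h5 h6 rfl rfl
          rfl
        exact this _ _ _ _ _ _ _ _ _ _ (by omega) (by omega)
      · intro a _ ha
        simp only [Finset.mem_range] at ha
        rw [dif_neg (by omega), map_zero]
  · intro s hs hs'
    simp only [Finset.mem_Ico, Finset.mem_range] at hs hs'
    refine Finset.sum_eq_zero fun a ha => ?_
    rw [dif_neg (by omega), map_zero]

lemma block_braid_left {n k x y c a a' : ℕ} (h1 : x + c = n) (h1' : c + x = n)
    (h2 : y + c = k) (h2' : c + y = k) (hk : k < n) (ha : a < y) (ha' : a' = c + a) :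
    E.comp (zero_add _) (E.braid x c h1 h1') (E.block n k a') =
      E.comp (add_zero _) (E.block n k a) (E.braid y c h2 h2') := by
  subst ha'
  rw [block_pos hk (a := c + a) (b := y - 1 - a) (s := n + 1 - k) (by omega) (by omega) (by omega),
    block_pos hk (a := a) (b := y - 1 - a + c) (s := n + 1 - k) (by omega) (by omega) (by omega)]
  exact (DGProp.win_braid_left a (y - 1 - a) c rfl rfl (by omega) (by omega) _ _ _ _ _ _ _ _ _).symm

lemma block_braid_right {n k x y c a a' : ℕ} (h1 : c + x = n) (h1' : x + c = n)
    (h2 : c + y = k) (h2' : y + c = k) (hk : k < n) (ha : a < y) (ha' : a' = c + a) :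
    E.comp (zero_add _) (E.braid c x h1 h1') (E.block n k a) =
      E.comp (add_zero _) (E.block n k a') (E.braid c y h2 h2') := by
  subst ha'
  rw [block_pos hk (a := c + a) (b := y - 1 - a) (s := n + 1 - k) (by omega) (by omega) (by omega),
    block_pos hk (a := a) (b := y - 1 - a + c) (s := n + 1 - k) (by omega) (by omega) (by omega)]
  exact (DGProp.win_braid_right a (y - 1 - a) c rfl rfl (by omega) (by omega) _ _ _ _ _ _ _ _ _).symm

lemma block_comm {n k j k' i i' : ℕ} {r : ℤ} (hr : r = n - j - 2) (hk : k < n) (hj : j < k)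
    (hk' : k + k' = n + j) (hi : i < i') (hi' : i' < j) :
    E.comp (r := r) (by omega) (E.block n k i) (E.block k j i') =
      sgn ((n - k - 1) * (k - j - 1)) •
        E.comp (by omega) (E.block n k' (i' + n - k)) (E.block k' j i) := by
  have key : ∀ (p q p' q' : ℤ) (h1 h2 h3 h4 h5 h6) (_ : p = p') (_ : q = q'),
      E.comp (p := p) (q := q) (r := r) h1
        (E.win i (k - 1 - i) (n := n) (m := k) (by omega) (by omega)
          (E.mul (n + 1 - k) p (by omega) h2))
        (E.win i' (j - 1 - i') (n := k) (m := j) (by omega) (by omega)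
          (E.mul (k + 1 - j) q (by omega) h3)) =
      sgn (p * q) • E.comp (p := q') (q := p') (r := r) h4
        (E.win (i' + n - k) (j - 1 - i') (n := n) (m := k') (by omega) (by omega)
          (E.mul (k + 1 - j) q' (by omega) h5))
        (E.win i (j - 1 - i) (n := k') (m := j) (by omega) (by omega)
          (E.mul (n + 1 - k) p' (by omega) h6)) := by
    rintro p q p' q' h1 h2 h3 h4 h5 h6 rfl rfl
    exact DGProp.win_disj i (i' - i - 1) (j - 1 - i') (by omega) (by omega) (by omega) (by omega)
      h1 (by omega) (by omega) (by omega) (by omega) (by omega) (by omega) (by omega) (by omega)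
      (by omega) _ _
  rw [block_pos hk (a := i) (b := k - 1 - i) (s := n + 1 - k) (by omega) (by omega) (by omega),
    block_pos hj (a := i') (b := j - 1 - i') (s := k + 1 - j) (by omega) (by omega) (by omega),
    block_pos (n := n) (k := k') (a := i' + n - k) (b := j - 1 - i') (s := k + 1 - j) (by omega)
      (by omega) (by omega) (by omega),
    block_pos (n := k') (k := j) (a := i) (b := j - 1 - i) (s := n + 1 - k) (by omega)
      (by omega) (by omega) (by omega)]
  exact key _ _ _ _ _ _ _ _ _ _ (by omega) (by omega)

lemma cyc_lt {n k i : ℕ} (h : i < k) : E.cyc n k i = sgn (i * (n - k)) • E.block n k i := by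
  simp [cyc, h]

lemma cyc_ge {n k i c : ℕ} (h : k ≤ i) (hc : i + c = n) (hc' : 0 < c) :
    E.cyc n k i = sgn (i * c) • E.comp (zero_add _) (E.braid i c hc (by omega))
      (E.block n k 0) := by
  obtain rfl : c = n - i := by omega
  have : ((n - i : ℕ) : ℤ) = n - i := by omega
  rw [cyc, if_neg (by omega), dif_pos (by omega), this]

/-- the starting point of the inner block -/
def inn (n j I a : ℕ) : ℕ := if j ≤ I ∧ n - I ≤ a then a - (n - I) else I + a

/-- the starting point of the outer block -/
def out (n k j I a : ℕ) : ℕ :=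
  if I < j then I else if n - I ≤ a then k - (n - I) else if I + a < k then I else
    if a = 0 then 0 else k - a

lemma comp_nested {n k j I a : ℕ} {p : ℤ} (hp : p + 1 = n - j - 1) (hj : j < k) (hk : k < n)
    (hj1 : 1 ≤ j) (hI : j ≤ I) (hI' : I < n) (ha : a ≤ k - j) :
    (sgn (I * (n - I)) * sgn (a + (n - k + 1) * (1 + a))) •
      E.comp (p := 0) (q := p) (zero_add p) (E.braid I (n - I) (by omega) (by omega))
        (E.comp (by omega) (E.block n k a) (E.block k j 0)) =
      sgn (n - k - 1) • E.comp (r := p) (by omega) (E.cyc n k (inn n j I a))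
        (E.cyc k j (out n k j I a)) := by
  obtain ⟨c, hc⟩ : ∃ c, I + c = n := ⟨n - I, by omega⟩
  have hc' : n - I = c := by omega
  have hcz : (n : ℤ) - I = c := by omega
  simp only [hc']
  rw [← E.assoc (pq := n - k - 1) (zero_add _) (by omega) (by omega) (zero_add p)]
  unfold inn out
  simp only [hc']
  rw [if_neg (show ¬ I < j by omega)]
  by_cases h1 : c ≤ a
  · rw [if_pos ⟨hI, h1⟩, if_pos h1]
    rw [block_braid_left (a := a - c) (y := k - c) (c := c) (x := I) hc (by omega) (by omega)
      (by omega) hk (by omega) (by omega),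
      E.assoc (add_zero _) (by omega) (zero_add _) (by omega), cyc_lt (by omega),
      cyc_ge (n := k) (i := k - c) (c := c) (by omega) (by omega) (by omega)]
    simp only [map_zsmul, AddMonoidHom.zsmul_apply, smul_smul, ← sgn_add]
    congr 1
    apply sgn_congr
    rw [show ((a - c : ℕ) : ℤ) = a - c by omega, show ((k - c : ℕ) : ℤ) = k - c by omega]
    rw [show (n : ℤ) = I + c by omega]
    simp only [Int.even_add, Int.even_sub, Int.even_mul, Int.not_even_one]
    by_cases e1 : Even (I : ℤ) <;> by_cases e2 : Even (c : ℤ) <;> by_cases e3 : Even (a : ℤ) <;>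
      by_cases e4 : Even (k : ℤ) <;> simp [e1, e2, e3, e4]
  · rw [if_neg (by omega), if_neg h1]
    by_cases h2 : I + a < k
    · rw [if_pos h2]
      rw [block_braid_right (a := a) (a' := I + a) (y := k - I) (c := I) (x := c) hc (by omega)
        (by omega) (by omega) hk (by omega) (by omega),
        E.assoc (add_zero _) (by omega) (zero_add _) (by omega), cyc_lt (by omega),
        cyc_ge (n := k) (i := I) (c := k - I) (by omega) (by omega) (by omega)]
      simp only [map_zsmul, AddMonoidHom.zsmul_apply, smul_smul, ← sgn_add]
      congr 1
      apply sgn_congr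
      push_cast
      rw [show ((k - I : ℕ) : ℤ) = k - I by omega]
      rw [show (n : ℤ) = I + c by omega]
      simp only [Int.even_add, Int.even_sub, Int.even_mul, Int.not_even_one]
      by_cases e1 : Even (I : ℤ) <;> by_cases e2 : Even (c : ℤ) <;> by_cases e3 : Even (a : ℤ) <;>
        by_cases e4 : Even (k : ℤ) <;> simp [e1, e2, e3, e4]
    · rw [if_neg h2]
      by_cases h3 : a = 0
      · subst h3
        rw [if_pos rfl, add_zero, cyc_ge (n := n) (i := I) (c := c) (by omega) hc (by omega), 
          cyc_lt (by omega)]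
        simp only [map_zsmul, AddMonoidHom.zsmul_apply, smul_smul, ← sgn_add]
        congr 1
        apply sgn_congr
        simp only [Nat.cast_zero, zero_mul, add_zero, zero_add, mul_one]
        rw [show (n : ℤ) = I + c by omega]
        simp only [Int.even_add, Int.even_sub, Int.even_mul, Int.not_even_one]
        by_cases e1 : Even (I : ℤ) <;> by_cases e2 : Even (c : ℤ) <;> 
          by_cases e4 : Even (k : ℤ) <;> simp [e1, e2, e4]
      · rw [if_neg h3, cyc_ge (n := n) (i := I + a) (c := c - a) (by omega) (by omega) (by omega),
          cyc_ge (n := k) (i := k - a) (c := a) (by omega) (by omega) (by omega)]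
        simp only [map_zsmul, AddMonoidHom.zsmul_apply, smul_smul, ← sgn_add]
        rw [← E.assoc (pq := n - k - 1) (add_zero _) (by omega) (zero_add _) (by omega),
          E.assoc (pq := n - k - 1) (zero_add _) (by omega) (add_zero _) (by omega),
          ← block_braid_left (a := 0) (a' := a) (y := k - a) (c := a) (x := n - a) (by omega)
            (by omega) (by omega) (by omega) hk (by omega) (by omega),
          ← E.assoc (pq := 0) (add_zero 0) (zero_add _) (zero_add _) (zero_add _),
          DGProp.braid_cyc (E := E.toDGProp) (a := I) (b := a) (c := c - a) (ab := I + a) (ca := n - a)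
            (bc := c) (n := n) rfl (by omega) (by omega) (by omega) (by omega) (by omega) (by omega) hc
            (by omega)]
        congr 1
        apply sgn_congr
        push_cast
        rw [show ((k - a : ℕ) : ℤ) = k - a by omega, show ((c - a : ℕ) : ℤ) = c - a by omega]
        rw [show (n : ℤ) = I + c by omega]
        simp only [Int.even_add, Int.even_sub, Int.even_mul, Int.not_even_one]
        by_cases e1 : Even (I : ℤ) <;> by_cases e2 : Even (c : ℤ) <;> by_cases e3 : Even (a : ℤ) <;>
          by_cases e4 : Even (k : ℤ) <;> simp [e1, e2, e3, e4]

lemma d_cyc {n j I : ℕ} {p : ℤ} (hp : p + 1 = n - j - 1) (hj1 : 1 ≤ j) (h : j < n) (hI : I < n) :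
    (E.hom n j).d ((n : ℤ) - j - 1) p (E.cyc n j I) =
      ∑ k ∈ Finset.Ioo j n, ∑ a ∈ Finset.range (k - j + 1), sgn (n - k - 1) •
        E.comp (by omega) (E.cyc n k (inn n j I a)) (E.cyc k j (out n k j I a)) := by
  by_cases hIj : I < j
  · rw [cyc_lt hIj, map_zsmul, d_block hp h hIj, Finset.smul_sum]
    refine Finset.sum_congr rfl fun k hk => ?_
    rw [Finset.smul_sum]
    refine Finset.sum_congr rfl fun a ha => ?_
    simp only [Finset.mem_Ioo, Finset.mem_range] at hk ha
    rw [inn, out, if_neg (by omega), if_pos hIj, cyc_lt (by omega), cyc_lt hIj]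
    simp only [map_zsmul, AddMonoidHom.zsmul_apply, smul_smul, ← sgn_add]
    congr 1
    apply sgn_congr
    push_cast
    simp only [Int.even_add, Int.even_sub, Int.even_mul, Int.not_even_one]
    by_cases e1 : Even (I : ℤ) <;> by_cases e2 : Even (n : ℤ) <;> by_cases e3 : Even (a : ℤ) <;>
      by_cases e4 : Even (k : ℤ) <;> simp [e1, e2, e3, e4]
  · have h0 : (-1 : ℤ) + 1 = 0 := by norm_num
    rw [cyc_ge (c := n - I) (by omega) (by omega) (by omega), map_zsmul,
      E.d_comp (zero_add _) h0 hp hp, E.d_braid, d_block hp h (by omega)]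
    simp only [map_zero, AddMonoidHom.zero_apply, zero_add, sgn_zero, one_smul, map_sum,
      Finset.smul_sum, map_zsmul]
    refine Finset.sum_congr rfl fun k hk => Finset.sum_congr rfl fun a ha => ?_
    simp only [Finset.mem_Ioo, Finset.mem_range] at hk ha
    rw [smul_smul, ← comp_nested hp hk.1 hk.2 hj1 (by omega) hI (by omega)]
    rw [show ((n - I : ℕ) : ℤ) = n - I by omega]

lemma comp_disj {n k j k' i i' : ℕ} {r : ℤ} (hr : r = n - j - 2) (hk : k < n) (hj : j < k)
    (hk' : k + k' = n + j) (hi : i < i') (hi' : i' < j) :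
    sgn (n - k - 1) • E.comp (r := r) (by omega) (E.cyc n k i) (E.cyc k j i') +
      sgn (n - k' - 1) • E.comp (by omega) (E.cyc n k' (i' + n - k)) (E.cyc k' j i) = 0 := by
  rw [cyc_lt (by omega), cyc_lt (by omega), cyc_lt (by omega), cyc_lt (by omega)]
  simp only [map_zsmul, AddMonoidHom.zsmul_apply, smul_smul]
  rw [block_comm hr hk hj hk' hi hi', smul_smul, ← add_smul]
  simp only [← sgn_add]
  rw [show ((i' + n - k : ℕ) : ℤ) = i' + n - k by omega]
  convert zero_smul ℤ _
  rw [← neg_eq_iff_add_eq_zero, ← neg_one_mul, ← sgn_one, ← sgn_add]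
  apply sgn_congr
  rw [show (n : ℤ) = k + k' - j by omega]
  simp only [Int.even_add, Int.even_sub, Int.even_mul, Int.not_even_one]
  by_cases e1 : Even (i : ℤ) <;> by_cases e2 : Even (i' : ℤ) <;> by_cases e3 : Even (j : ℤ) <;>
    by_cases e4 : Even (k : ℤ) <;> by_cases e5 : Even (k' : ℤ) <;> simp [e1, e2, e3, e4, e5]

lemma comp_disj' {n k j k' i i' : ℕ} {r : ℤ} (hr : r = n - j - 2) (hk : k < n) (hj : j < k)
    (hk' : k + k' = n + j) (hi : k ≤ i) (hin : i < n) (hi0 : 0 < i') (hi' : i' < j) :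
    sgn (n - k - 1) • E.comp (r := r) (by omega) (E.cyc n k i) (E.cyc k j i') +
      sgn (n - k' - 1) • E.comp (by omega) (E.cyc n k' (i' + i - k))
        (E.cyc k' j (i + j - k)) = 0 := by
  obtain ⟨c, hc⟩ : ∃ c, i + c = n := ⟨n - i, by omega⟩
  rw [cyc_ge (c := c) (by omega) (by omega) (by omega), cyc_lt (by omega), cyc_lt (by omega),
    cyc_ge (i := i + j - k) (c := c) (by omega) (by omega) (by omega)]
  simp only [map_zsmul, AddMonoidHom.zsmul_apply, smul_smul]
  rw [E.assoc (qr := r) (zero_add _) (by omega) (by omega) (by omega), block_comm hr hk hj hk' hi0 hi',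
    map_zsmul, ← E.assoc (pq := n - k' - 1) (zero_add _) (by omega) (by omega) (by omega),
    block_braid_left (a := i' + i - k) (y := i + j - k) (c := c) (x := i) hc (by omega) (by omega)
      (by omega) (by omega) (by omega) (by omega),
    E.assoc (add_zero _) (by omega) (zero_add _) (by omega), smul_smul, ← add_smul]
  simp only [← sgn_add]
  rw [show ((i' + i - k : ℕ) : ℤ) = i' + i - k by omega,
    show ((i + j - k : ℕ) : ℤ) = i + j - k by omega]
  convert zero_smul ℤ _
  rw [← neg_eq_iff_add_eq_zero, ← neg_one_mul, ← sgn_one, ← sgn_add]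
  apply sgn_congr
  rw [show (n : ℤ) = i + c by omega, show (i : ℤ) = k + k' - j - c by omega]
  simp only [Int.even_add, Int.even_sub, Int.even_mul, Int.not_even_one]
  by_cases e1 : Even (c : ℤ) <;> by_cases e2 : Even (i' : ℤ) <;> by_cases e3 : Even (j : ℤ) <;>
    by_cases e4 : Even (k : ℤ) <;> by_cases e5 : Even (k' : ℤ) <;> simp [e1, e2, e3, e4, e5]

/-- whether the second block contains the value of the first one -/
def Nested (j k i i' : ℕ) : Prop :=
  (i' < j ∧ i < k ∧ i' ≤ i ∧ i + j ≤ i' + k) ∨ (i' < j ∧ k ≤ i ∧ i' = 0) ∨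
    (j ≤ i' ∧ i < k ∧ (i + j ≤ i' ∨ i' ≤ i)) ∨ (j ≤ i' ∧ k ≤ i)

instance (j k i i' : ℕ) : Decidable (Nested j k i i') := by
  unfold Nested; infer_instance

/-- starting point of the second block, when taken first -/
def swp₁ (n j k i i' : ℕ) : ℕ :=
  if i < k then (if i' < j then (if i < i' then i' + n - k else i') else n + i' - k)
  else i' + i - k

/-- starting point of the first block, when taken second -/
def swp₂ (j k i i' : ℕ) : ℕ :=
  if i < k then (if i' < j then (if i < i' then i else i + j - k) else i + j - i')
  else i + j - k

/-- triples of natural numbers -/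
abbrev Triple : Type := Σ _ : ℕ, Σ _ : ℕ, ℕ

lemma triple_ext {a b c a' b' c' : ℕ} (h : a = a') (h' : b = b') (h'' : c = c') :
    (⟨a, b, c⟩ : Triple) = ⟨a', b', c'⟩ := by
  subst h h' h''; rfl

set_option maxHeartbeats 2000000 in
/-- The twisting equation for the morphisms `f_{n,k}`. -/
theorem hochTerm_mc (n j : ℕ) (hj1 : 1 ≤ j) (h : j < n) {p : ℤ} (hp : p + 1 = n - j - 1) :
    (E.hom n j).d ((n : ℤ) - j - 1) p (E.hochTerm n j) +
      ∑ k ∈ Finset.Ioo j n, sgn (n - k - 1) •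
        E.comp (by omega) (E.hochTerm n k) (E.hochTerm k j) = 0 := by
  unfold hochTerm
  simp only [map_neg, map_sum, AddMonoidHom.neg_apply, AddMonoidHom.finsetSum_apply]
  rw [Finset.sum_congr rfl fun I hI => d_cyc hp hj1 h (Finset.mem_range.1 hI)]
  simp only [Finset.sum_neg_distrib, neg_neg, Finset.smul_sum]
  set T : Triple → (E.hom n j).X p := fun x =>
    sgn (n - x.1 - 1) • E.comp (by omega) (E.cyc n x.1 x.2.1) (E.cyc x.1 j x.2.2) with hT
  have e1 : ∑ k ∈ Finset.Ioo j n, ∑ i' ∈ Finset.range k, ∑ i ∈ Finset.range n,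
      sgn (n - k - 1) • E.comp (r := p) (by omega) (E.cyc n k i) (E.cyc k j i') =
      ∑ x ∈ (Finset.Ioo j n).sigma fun k => (Finset.range n).sigma fun _ => Finset.range k,
        T x := by
    rw [Finset.sum_sigma]
    refine Finset.sum_congr rfl fun k _ => ?_
    rw [Finset.sum_comm, Finset.sum_sigma]
  have e2 : ∑ I ∈ Finset.range n, ∑ k ∈ Finset.Ioo j n, ∑ a ∈ Finset.range (k - j + 1),
      sgn (n - k - 1) • E.comp (r := p) (by omega) (E.cyc n k (inn n j I a))
        (E.cyc k j (out n k j I a)) =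
      ∑ x ∈ (Finset.Ioo j n).sigma fun k => (Finset.range n).sigma fun _ =>
        Finset.range (k - j + 1), T ⟨x.1, inn n j x.2.1 x.2.2, out n x.1 j x.2.1 x.2.2⟩ := by
    rw [Finset.sum_comm, Finset.sum_sigma]
    refine Finset.sum_congr rfl fun k _ => ?_
    rw [Finset.sum_sigma]
  have e5 := Finset.sum_filter_add_sum_filter_not ((Finset.Ioo j n).sigma fun k =>
    (Finset.range n).sigma fun _ => Finset.range k)
    (fun x : Triple => Nested j x.1 x.2.1 x.2.2) T
  have e3 : ∑ x ∈ (((Finset.Ioo j n).sigma fun k => (Finset.range n).sigma fun _ =>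
      Finset.range k).filter fun x : Σ _ : ℕ, Σ _ : ℕ, ℕ => ¬ Nested j x.1 x.2.1 x.2.2), T x = 0 := by
    refine Finset.sum_involution (fun x _ => ⟨n + j - x.1, swp₁ n j x.1 x.2.1 x.2.2, swp₂ j x.1 x.2.1 x.2.2⟩) ?_ ?_ ?_ ?_
    · rintro ⟨k, i, i'⟩ hx
      simp only [Finset.mem_filter, Finset.mem_sigma, Finset.mem_Ioo, Finset.mem_range] at hx
      unfold Nested at hx
      obtain ⟨⟨⟨hk1, hk2⟩, hi, hi'⟩, hn⟩ := hx
      have hr : p = n - j - 2 := by omega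
      simp only [hT]
      by_cases h1 : i < k
      · by_cases h2 : i' < j
        · by_cases h3 : i < i'
          · simp only [swp₁, swp₂, h1, h2, h3, if_true]
            exact comp_disj hr hk2 hk1 (by omega) h3 h2
          · simp only [swp₁, swp₂, h1, h2, h3, if_true, if_false]
            have := comp_disj (E := E) (n := n) (k := n + j - k) (j := j) (k' := k) (i := i')
              (i' := i + j - k) hr (by omega) (by omega) (by omega) (by omega) (by omega)
            rw [add_comm]
            rwa [show i + j - k + n - (n + j - k) = i by omega] at this
        · simp only [swp₁, swp₂, h1, h2, if_true, if_false]
          have := comp_disj' (E := E) (n := n) (k := n + j - k) (j := j) (k' := k)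
            (i := n + i' - k) (i' := i + j - i') hr (by omega) (by omega) (by omega) (by omega)
            (by omega) (by omega) (by omega)
          rw [add_comm]
          rwa [show i + j - i' + (n + i' - k) - (n + j - k) = i by omega,
            show n + i' - k + j - (n + j - k) = i' by omega] at this
      · simp only [swp₁, swp₂, h1, if_false]
        exact comp_disj' hr hk2 hk1 (by omega) (by omega) hi (by omega) (by omega)
    · rintro ⟨k, i, i'⟩ hx _
      simp only [Finset.mem_filter, Finset.mem_sigma, Finset.mem_Ioo, Finset.mem_range] at hx
      unfold Nested at hx
      obtain ⟨⟨⟨hk1, hk2⟩, hi, hi'⟩, hn⟩ := hx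
      intro he
      have he1 : n + j - k = k := congrArg (fun x : Triple => x.1) he
      have he2 : swp₁ n j k i i' = i := congrArg (fun x : Triple => x.2.1) he
      have he3 : swp₂ j k i i' = i' := congrArg (fun x : Triple => x.2.2) he
      unfold swp₁ at he2
      unfold swp₂ at he3
      split_ifs at he2 he3 <;> omega
    · rintro ⟨k, i, i'⟩ hx
      simp only [Finset.mem_filter, Finset.mem_sigma, Finset.mem_Ioo, Finset.mem_range] at hx
      unfold Nested at hx
      obtain ⟨⟨⟨hk1, hk2⟩, hi, hi'⟩, hn⟩ := hx
      simp only [Finset.mem_filter, Finset.mem_sigma, Finset.mem_Ioo, Finset.mem_range]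
      unfold Nested swp₁ swp₂
      split_ifs with h1 h2 h3 <;> omega
    · rintro ⟨k, i, i'⟩ hx
      simp only [Finset.mem_filter, Finset.mem_sigma, Finset.mem_Ioo, Finset.mem_range] at hx
      unfold Nested at hx
      obtain ⟨⟨⟨hk1, hk2⟩, hi, hi'⟩, hn⟩ := hx
      dsimp only
      refine triple_ext (by omega) ?_ ?_
      · by_cases h1 : i < k
        · by_cases h2 : i' < j
          · by_cases h3 : i < i'
            · simp only [swp₁, swp₂, h1, h2, h3, if_true]
              split_ifs <;> omega
            · simp only [swp₁, swp₂, h1, h2, h3, if_true, if_false]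
              split_ifs <;> omega
          · simp only [swp₁, swp₂, h1, h2, if_true, if_false]
            split_ifs <;> omega
        · simp only [swp₁, swp₂, h1, if_false]
          split_ifs <;> omega
      · by_cases h1 : i < k
        · by_cases h2 : i' < j
          · by_cases h3 : i < i'
            · simp only [swp₁, swp₂, h1, h2, h3, if_true]
              split_ifs <;> omega
            · simp only [swp₁, swp₂, h1, h2, h3, if_true, if_false]
              split_ifs <;> omega
          · simp only [swp₁, swp₂, h1, h2, if_true, if_false]
            split_ifs <;> omega
        · simp only [swp₁, swp₂, h1, if_false]
          split_ifs <;> omega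
  have e4 : ∑ x ∈ (Finset.Ioo j n).sigma fun k => (Finset.range n).sigma fun _ =>
        Finset.range (k - j + 1), T ⟨x.1, inn n j x.2.1 x.2.2, out n x.1 j x.2.1 x.2.2⟩ =
      ∑ x ∈ (((Finset.Ioo j n).sigma fun k => (Finset.range n).sigma fun _ =>
      Finset.range k).filter fun x : Triple => Nested j x.1 x.2.1 x.2.2), T x := by
    refine Finset.sum_nbij' (fun x => ⟨x.1, inn n j x.2.1 x.2.2, out n x.1 j x.2.1 x.2.2⟩)
      (fun x => ⟨x.1,
        if x.2.2 < j then (if x.2.1 < x.1 then x.2.2 else x.2.1)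
        else if x.2.1 < x.1 then (if x.2.1 + j ≤ x.2.2 then n + x.2.2 - x.1 else x.2.2)
        else x.2.1 + x.2.2 - x.1,
        if x.2.2 < j then (if x.2.1 < x.1 then x.2.1 - x.2.2 else 0)
        else if x.2.1 < x.1 then
          (if x.2.1 + j ≤ x.2.2 then x.2.1 + x.1 - x.2.2 else x.2.1 - x.2.2)
        else x.1 - x.2.2⟩) ?_ ?_ ?_ ?_ ?_
    · rintro ⟨k, I, a⟩ hx
      simp only [Finset.mem_sigma, Finset.mem_Ioo, Finset.mem_range] at hx
      obtain ⟨⟨hk1, hk2⟩, hI, ha⟩ := hx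
      simp only [Finset.mem_filter, Finset.mem_sigma, Finset.mem_Ioo, Finset.mem_range]
      unfold Nested inn out
      split_ifs <;> omega
    · rintro ⟨k, i, i'⟩ hx
      simp only [Finset.mem_filter, Finset.mem_sigma, Finset.mem_Ioo, Finset.mem_range] at hx
      unfold Nested at hx
      obtain ⟨⟨⟨hk1, hk2⟩, hi, hi'⟩, hn⟩ := hx
      simp only [Finset.mem_sigma, Finset.mem_Ioo, Finset.mem_range]
      split_ifs <;> omega
    · rintro ⟨k, I, a⟩ hx
      simp only [Finset.mem_sigma, Finset.mem_Ioo, Finset.mem_range] at hx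
      obtain ⟨⟨hk1, hk2⟩, hI, ha⟩ := hx
      dsimp only
      refine triple_ext rfl ?_ ?_
      all_goals unfold inn out
      all_goals split_ifs <;> omega
    · rintro ⟨k, i, i'⟩ hx
      simp only [Finset.mem_filter, Finset.mem_sigma, Finset.mem_Ioo, Finset.mem_range] at hx
      unfold Nested at hx
      obtain ⟨⟨⟨hk1, hk2⟩, hi, hi'⟩, hn⟩ := hx
      dsimp only
      by_cases h1 : i' < j <;> by_cases h2 : i < k <;> by_cases h3 : i + j ≤ i' <;>
        simp only [h1, h2, h3, if_true, if_false]
      all_goals refine triple_ext rfl ?_ ?_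
      all_goals first | unfold inn | unfold out
      all_goals split_ifs <;> omega
    · rintro ⟨k, I, a⟩ _
      rfl
  rw [e1, e2, e4, ← e5, e3, add_zero, neg_add_cancel]

end AinfProp

/-- The action data of a dg-functor `A ⟶ Ch` with underlying graded groups `X a p`: the
differentials, and the action of the morphisms of `A`, given by chain maps
`X a ⊗ hom a b ⟶ X b`. -/
@[ext]
structure DGModule {O : Type w} (A : DGCat.{u} O) (X : O → ℤ → AddCommGrpCat.{u}) where
  d (a : O) (p q : ℤ) : X a p →+ X a q
  shape (a : O) (p q : ℤ) (h : q + 1 ≠ p) : d a p q = 0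
  d_d (a : O) (p q r : ℤ) (x : X a p) : d a q r (d a p q x) = 0
  act {a b : O} {p q r : ℤ} (h : p + q = r) : X a p →+ (A.hom a b).X q →+ X b r
  act_id {a : O} {p : ℤ} (x : X a p) : act (add_zero p) x (A.id a) = x
  act_comp {a b c : O} {p q r pq qr s : ℤ} (h₁ : p + q = pq) (h₂ : pq + r = s)
    (h₃ : q + r = qr) (h₄ : p + qr = s)
    (x : X a p) (f : (A.hom a b).X q) (g : (A.hom b c).X r) :
    act h₂ (act h₁ x f) g = act h₄ x (A.comp h₃ f g)
  d_act {a b : O} {p q r p' q' r' : ℤ} (h : p + q = r)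
    (hp : p' + 1 = p) (hq : q' + 1 = q) (hr : r' + 1 = r) (x : X a p) (f : (A.hom a b).X q) :
    d b r r' (act h x f) =
      act (by omega) (d a p p' x) f + sgn p • act (by omega) x ((A.hom a b).d q q' f)

/-- A dg-functor from `A` to the dg-category of chain complexes. -/
structure DGFunctor {O : Type w} (A : DGCat.{u} O) where
  X : O → ℤ → AddCommGrpCat.{u}
  str : DGModule A X

/-- Homogeneous maps of degree `s` between families of graded groups. -/
abbrev GrHom {O : Type w} (X Y : O → ℤ → AddCommGrpCat.{u}) (s : ℤ) : Type (max u w) :=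
  ∀ (a : O) (p q : ℤ), p + s = q → (X a p →+ Y a q)

/-- Naturality of a homogeneous map between dg-functors:
`(x ⬝ f) θ = (-1)^(|f||θ|) (x θ) ⬝ f`. -/
def GrHom.IsNat {O : Type w} {A : DGCat.{u} O} {X Y : O → ℤ → AddCommGrpCat.{u}}
    (S : DGModule A X) (T : DGModule A Y) {s : ℤ} (θ : GrHom X Y s) : Prop :=
  ∀ ⦃a b : O⦄ ⦃p q r p' r' : ℤ⦄ (h : p + q = r) (hp : p + s = p') (hr : r + s = r')
    (x : X a p) (f : (A.hom a b).X q),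
    θ b r r' hr (S.act h x f) = sgn (q * s) • T.act (by omega) (θ a p p' hp x) f

/-- The elements of degree `s` of the complex of natural transformations `Φ ⟶ Ψ`. -/
structure DGTrans {O : Type w} {A : DGCat.{u} O} (Φ Ψ : DGFunctor A) (s : ℤ) where
  app : GrHom Φ.X Ψ.X s
  naturality : GrHom.IsNat Φ.str Ψ.str app

section Hoch

variable (X Y : ℕ → ℤ → AddCommGrpCat.{u})

/-- The underlying graded groups `⨁_{n ≥ 1} X(n + m)[n - 1]` of the Hochschild complex; the
summand `n = j + 1` is indexed by `j`. -/
def hochX (m : ℕ) (p : ℤ) : AddCommGrpCat.{u} :=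
  AddCommGrpCat.of (DirectSum ℕ fun j => X (j + 1 + m) (p - j))

variable {X Y}

/-- The inclusion `x ↦ x ⊗ l_{j+1}` of a summand. -/
def hochInc (j : ℕ) {m : ℕ} {p' p : ℤ} (h : p' + j = p) : X (j + 1 + m) p' →+ hochX X m p :=
  (DirectSum.of (fun j : ℕ => X (j + 1 + m) (p - j)) j).comp
    (eqToHom (congrArg (X (j + 1 + m)) (by omega : p' = p - j))).hom

/-- Homomorphisms out of the direct sum. -/
def hochDesc {m : ℕ} {p : ℤ} {B : Type*} [AddCommGroup B]
    (F : ∀ (j : ℕ) (p' : ℤ), p' + j = p → (X (j + 1 + m) p' →+ B)) : hochX X m p →+ B :=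
  DirectSum.toAddMonoid fun j => F j (p - j) (by omega)

@[simp]
lemma hochDesc_inc {m : ℕ} {p : ℤ} {B : Type*} [AddCommGroup B]
    (F : ∀ (j : ℕ) (p' : ℤ), p' + j = p → (X (j + 1 + m) p' →+ B)) (j : ℕ) {p' : ℤ}
    (h : p' + j = p) (x : X (j + 1 + m) p') : hochDesc F (hochInc j h x) = F j p' h x := by
  obtain rfl : p' = p - j := by omega
  simp only [hochDesc, hochInc, eqToHom_refl]
  exact DirectSum.toAddMonoid_of _ _ _

lemma hoch_hom_ext {m : ℕ} {p : ℤ} {B : Type*} [AddCommGroup B] {f g : hochX X m p →+ B}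
    (h : ∀ (j : ℕ) (p' : ℤ) (hp : p' + j = p) (x : X (j + 1 + m) p'),
      f (hochInc j hp x) = g (hochInc j hp x)) : f = g := by
  refine DirectSum.addHom_ext fun j x => ?_
  have := h j (p - j) (by omega) x
  simp only [hochInc, eqToHom_refl] at this
  exact this

/-- The map induced on Hochschild complexes by a homogeneous map of degree `s`. -/
def hochMap {s : ℤ} (θ : GrHom X Y s) : GrHom (hochX X) (hochX Y) s := fun m p q h =>
  hochDesc fun j p' hp =>
    sgn (j * s) • (hochInc j (by omega)).comp (θ (j + 1 + m) p' (p' + s) rfl)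

lemma hochMap_inc {s : ℤ} (θ : GrHom X Y s) {m : ℕ} {p q p' q' : ℤ} (h : p + s = q) (j : ℕ)
    (hp : p' + j = p) (hq : q' + j = q) (hs : p' + s = q') (x : X (j + 1 + m) p') :
    hochMap θ m p q h (hochInc j hp x) = sgn (j * s) • hochInc j hq (θ _ p' q' hs x) := by
  subst hs
  simp [hochMap]

namespace AinfProp

variable (E : AinfProp.{u})

/-- `f_{j+1,i+1} ⊗ id_m` -/
def hochOp (m j i : ℕ) :
    (E.hom (j + 1 + m) (i + 1 + m)).X (((j + 1 : ℕ) : ℤ) - ((i + 1 : ℕ) : ℤ) - 1) :=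
  E.win 0 m (by omega) (by omega) (E.hochTerm (j + 1) (i + 1))

variable {E}

/-- The differential
`x ⊗ l_n ↦ dx ⊗ l_n + (-1)^|x| ∑_{k < n} x ⬝ (f_{n,k} ⊗ id_m) ⊗ l_k` of the Hochschild complex. -/
def hochD (S : DGModule E.toDGCat X) (m : ℕ) (p q : ℤ) : hochX X m p →+ hochX X m q :=
  if hq : q + 1 = p then
    hochDesc fun j p' hp =>
      (hochInc j (by omega)).comp (S.d (j + 1 + m) p' (p' - 1)) +
        sgn p' • ∑ i ∈ Finset.range j,
          (hochInc i (p' := q - i) (by omega)).comp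
            ((S.act (by omega)).flip (E.hochOp m j i))
  else 0

/-- The action `(x ⊗ l_n) ⬝ f = (-1)^((n-1)|f|) x ⬝ (id_n ⊗ f) ⊗ l_n` on the Hochschild complex. -/
def hochAct (S : DGModule E.toDGCat X) {m m' : ℕ} {p q r : ℤ} (h : p + q = r) :
    hochX X m p →+ (E.hom m m').X q →+ hochX X m' r :=
  hochDesc fun j p' hp => sgn (j * q) • AddMonoidHom.mk'
    (fun x => (hochInc j (p' := p' + q) (by omega)).comp
      ((S.act rfl x).comp (E.win (j + 1) 0 (by omega) (by omega))))
    (fun x y => by ext f; simp)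

lemma hochD_inc (S : DGModule E.toDGCat X) {m : ℕ} {p q p' q' : ℤ} (hq : q + 1 = p) {j : ℕ}
    (hp : p' + j = p) (hq' : q' + j = q) (x : X (j + 1 + m) p') :
    hochD S m p q (hochInc j hp x) = hochInc j hq' (S.d _ p' q' x) +
      sgn p' • ∑ i ∈ Finset.range j, hochInc i (p' := q - i) (by omega)
        (S.act (by omega) x (E.hochOp m j i)) := by
  obtain rfl : q' = p' - 1 := by omega
  simp [hochD, hq, AddMonoidHom.finsetSum_apply]

lemma hochAct_inc (S : DGModule E.toDGCat X) {m m' : ℕ} {p q r p' r' : ℤ} (h : p + q = r)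
    {j : ℕ} (hp : p' + j = p) (hr : r' + j = r) (h' : p' + q = r') (x : X (j + 1 + m) p')
    (f : (E.hom m m').X q) :
    hochAct S h (hochInc j hp x) f =
      sgn (j * q) • hochInc j hr (S.act h' x (E.win (j + 1) 0 (by omega) (by omega) f)) := by
  subst h'
  simp [hochAct]

lemma d_hochOp {m j l : ℕ} (h : l < j) {p : ℤ} (hp : p + 1 = (j + 1 : ℕ) - (l + 1 : ℕ) - 1) :
    (E.hom _ _).d _ p (E.hochOp m j l) + ∑ i ∈ Finset.Ioo l j, sgn (j - i - 1) •
      E.comp (by omega) (E.hochOp m j i) (E.hochOp m i l) = 0 := by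
  have := hochTerm_mc (E := E) (j + 1) (l + 1) (by omega) (by omega) hp
  have h2 : ∑ i ∈ Finset.Ioo l j, sgn (j - i - 1) •
      E.comp (r := p) (by omega) (E.hochOp m j i) (E.hochOp m i l) =
      E.win 0 m (by omega) (by omega) (∑ k ∈ Finset.Ioo (l + 1) (j + 1),
        sgn ((j + 1 : ℕ) - k - 1) •
          E.comp (by omega) (E.hochTerm (j + 1) k) (E.hochTerm k (l + 1))) := by
    rw [map_sum]
    refine Finset.sum_nbij' (fun i => i + 1) (fun k => k - 1) ?_ ?_ ?_ ?_ ?_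
    · intro i; simp only [Finset.mem_Ioo]; omega
    · intro i; simp only [Finset.mem_Ioo]; omega
    · intro i; simp only [Finset.mem_Ioo]; omega
    · intro i; simp only [Finset.mem_Ioo]; omega
    · intro i _
      simp only [hochOp]
      rw [DGProp.comp_win, map_zsmul]
      congr 1
      congr 1
      push_cast
      ring
  rw [h2, hochOp, DGProp.d_win _ _ _ _ hp, ← map_add, this, map_zero]

lemma hochOp_comm {m m' j i : ℕ} {q r : ℤ} (h : ((j + 1 : ℕ) : ℤ) - (i + 1 : ℕ) - 1 + q = r)
    (f : (E.hom m m').X q) :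
    E.comp h (E.hochOp m j i) (E.win (i + 1) 0 (by omega) (by omega) f) =
      sgn ((j - i - 1) * q) • E.comp (by omega) (E.win (j + 1) 0 (by omega) (by omega) f)
        (E.hochOp m' j i) := by
  have := DGProp.win_disj (E := E.toDGProp) 0 0 0 (bl := j + 1) (bl' := i + 1) (br := m)
    (br' := m') (n := j + 1 + m) (k := i + 1 + m) (k' := j + 1 + m') (m := i + 1 + m')
    (by omega) (by omega) (by omega) (by omega) h (by omega) (by omega) (by omega) (by omega)
    (by omega) (by omega) (by omega) (by omega) (by omega) (E.hochTerm (j + 1) (i + 1)) f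
  rw [hochOp, hochOp, this]
  congr 2
  push_cast
  ring

/-- The Hochschild complex `C(Φ)` of a dg-functor `Φ`, with its action of `E`. -/
def hochStr (S : DGModule E.toDGCat X) : DGModule E.toDGCat (hochX X) where
  d := hochD S
  shape m p q h := by simp [hochD, h]
  d_d m p q r x := by
    by_cases hq : q + 1 = p
    swap
    · simp [hochD, hq]
    by_cases hr : r + 1 = q
    swap
    · simp [hochD, hr]
    have : (hochD S m q r).comp (hochD S m p q) = 0 := by
      refine hoch_hom_ext fun j p' hp x => ?_
      have key : ∀ l ∈ Finset.range j, hochInc (X := X) (m := m) l (p' := r - l) (by omega)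
          (S.act (by omega) x ((E.hom _ _).d _ (j - l - 2) (E.hochOp m j l))) +
          ∑ i ∈ Finset.Ioo l j, sgn (j - i - 1) • hochInc l (p' := r - l) (p := r) (by omega)
            (S.act (q := (i + 1 : ℕ) - (l + 1 : ℕ) - 1) (p := q - i) (by omega)
              (S.act (by omega) x (E.hochOp m j i)) (E.hochOp m i l)) = 0 := by
        intro l hl
        have := d_hochOp (E := E) (m := m) (Finset.mem_range.1 hl) (p := j - l - 2) (by omega)
        have := congrArg (fun z => hochInc (X := X) (m := m) l (p' := r - l) (p := r) (by omega)
          (S.act (p := p') (by omega) x z)) this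
        simp only [map_add, map_sum, map_zsmul, map_zero] at this
        rw [← this]
        congr 1
        refine Finset.sum_congr rfl fun i _ => ?_
        congr 2
        exact S.act_comp ..
      have hs : sgn (p' - 1) = - sgn p' := by
        rw [sub_eq_add_neg, sgn_add, show sgn (-1) = -1 by simp [sgn], mul_neg_one]
      have e1 : ∀ i ∈ Finset.range j, hochD S m q r (hochInc i (p' := q - i) (by omega)
          (S.act (by omega) x (E.hochOp m j i))) =
          hochInc i (p' := r - i) (by omega) (S.act (by omega) (S.d _ p' (p' - 1) x)
            (E.hochOp m j i)) +
          sgn p' • hochInc i (p' := r - i) (by omega) (S.act (by omega) x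
            ((E.hom _ _).d _ (j - i - 2) (E.hochOp m j i))) +
          sgn (q - i) • ∑ l ∈ Finset.range i, hochInc l (p' := r - l) (by omega)
            (S.act (by omega) (S.act (p := p') (r := q - i) (by omega) x (E.hochOp m j i))
              (E.hochOp m i l)) := by
        intro i hi
        rw [hochD_inc S hr (q' := r - i) _ (by omega),
          S.d_act _ (p' := p' - 1) (q' := j - i - 2) (by omega) (by omega) (by omega), map_add,
          map_zsmul]
      rw [AddMonoidHom.comp_apply, AddMonoidHom.zero_apply, hochD_inc S hq (q' := p' - 1) hp
        (by omega), map_add, map_zsmul, map_sum, Finset.sum_congr rfl e1,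
        hochD_inc S hr (q' := p' - 2) (by omega) (by omega), S.d_d, map_zero, zero_add, hs]
      simp only [Finset.sum_add_distrib, smul_add, neg_smul]
      have e0 : ∀ A B C : hochX X m r, -A + (A + B + C) = B + C := by intros; abel
      rw [e0, ← Finset.smul_sum, smul_smul, sgn_mul_self, one_smul]
      have e2 : sgn p' • ∑ i ∈ Finset.range j, sgn (q - i) • ∑ l ∈ Finset.range i,
          hochInc (X := X) (m := m) l (p' := r - l) (p := r) (by omega)
            (S.act (by omega) (S.act (p := p') (r := q - i) (by omega) x (E.hochOp m j i))
              (E.hochOp m i l)) =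
          ∑ l ∈ Finset.range j, ∑ i ∈ Finset.Ioo l j, sgn (j - i - 1) •
            hochInc l (p' := r - l) (p := r) (by omega)
            (S.act (q := (i + 1 : ℕ) - (l + 1 : ℕ) - 1) (p := q - i) (by omega)
              (S.act (by omega) x (E.hochOp m j i)) (E.hochOp m i l)) := by
        simp only [Finset.smul_sum, smul_smul, ← sgn_add]
        rw [Finset.sum_comm' (t' := Finset.range j) (s' := fun l => Finset.Ioo l j)]
        · refine Finset.sum_congr rfl fun l _ => Finset.sum_congr rfl fun i _ => ?_
          congr 1
          apply sgn_congr
          exact ⟨p', by omega⟩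
        · intro i l
          simp only [Finset.mem_range, Finset.mem_Ioo]
          omega
      rw [e2, ← Finset.sum_add_distrib]
      exact Finset.sum_eq_zero key
    exact DFunLike.congr_fun this x
  act := hochAct S
  act_id {m p} x := by
    have : (hochAct S (add_zero p)).flip (E.id m) = AddMonoidHom.id _ := by
      refine hoch_hom_ext fun j p' hp x => ?_
      rw [AddMonoidHom.flip_apply, hochAct_inc S _ hp hp (add_zero p'), DGProp.win_id, S.act_id,
        mul_zero, sgn_zero, one_smul, AddMonoidHom.id_apply]
    exact DFunLike.congr_fun this x
  act_comp {a b c p q r pq qr s} h₁ h₂ h₃ h₄ x f g := by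
    have : ((hochAct S h₂).flip g).comp ((hochAct S h₁).flip f) =
        (hochAct S h₄).flip (E.comp h₃ f g) := by
      refine hoch_hom_ext fun j p' hp x => ?_
      simp only [AddMonoidHom.comp_apply, AddMonoidHom.flip_apply]
      rw [hochAct_inc S h₁ hp (r' := p' + q) (by omega) rfl, map_zsmul, AddMonoidHom.zsmul_apply,
        hochAct_inc S h₂ _ (r' := p' + q + r) (by omega) rfl,
        hochAct_inc S h₄ hp (r' := p' + q + r) (by omega) (by omega),
        S.act_comp rfl rfl h₃ (by omega), DGProp.comp_win, smul_smul, ← sgn_add]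
      congr 2
      rw [← h₃]; ring
    exact DFunLike.congr_fun this x
  d_act {a b p q r p' q' r'} h hp hq hr x f := by
    have : (hochD S b r r').comp ((hochAct S h).flip f) =
        ((hochAct S (by omega)).flip f).comp (hochD S a p p') +
          sgn p • (hochAct S (by omega)).flip ((E.hom a b).d q q' f) := by
      refine hoch_hom_ext fun j k hk x => ?_
      simp only [AddMonoidHom.comp_apply, AddMonoidHom.flip_apply, AddMonoidHom.add_apply,
        AddMonoidHom.zsmul_apply]
      have e1 : ∀ i ∈ Finset.range j, hochInc (X := X) (p := r') i (p' := r' - i) (by omega)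
          (S.act (by omega) (S.act (p := k) (r := k + q) rfl x
            (E.win (j + 1) 0 (by omega) (by omega) f)) (E.hochOp b j i)) =
          sgn ((j - i - 1) * q) • hochInc i (p' := r' - i) (by omega)
          (S.act (by omega) (S.act (p := k) (r := p' - i) (by omega) x (E.hochOp a j i))
            (E.win (i + 1) 0 (by omega) (by omega) f)) := by
        intro i _
        rw [S.act_comp rfl (by omega) (qr := r' - i - k) (by omega) (by omega),
          S.act_comp (by omega) (by omega) (qr := r' - i - k) (by omega) (by omega),
          hochOp_comm, map_zsmul, map_zsmul, smul_smul, sgn_mul_self, one_smul]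
      rw [hochAct_inc S h hk (r' := k + q) (by omega) rfl, map_zsmul,
        hochD_inc S hr (q' := k + q - 1) _ (by omega), Finset.sum_congr rfl e1,
        S.d_act rfl (p' := k - 1) (q' := q') (by omega) hq (by omega),
        hochD_inc S hp (q' := k - 1) hk (by omega)]
      have e3 : ∀ i ∈ Finset.range j, hochAct S (p := p') (r := r') (by omega) (hochInc i (p' := p' - i)
          (by omega) (S.act (p := k) (by omega) x (E.hochOp a j i))) f =
          sgn (i * q) • hochInc i (p := r') (p' := r' - i) (by omega)
          (S.act (by omega) (S.act (p := k) (r := p' - i) (by omega) x (E.hochOp a j i))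
            (E.win (i + 1) 0 (by omega) (by omega) f)) := by
        intro i _
        rw [hochAct_inc S _ _ (r' := r' - i) (by omega) (by omega)]
      simp only [map_add, map_zsmul, map_sum, AddMonoidHom.add_apply, AddMonoidHom.zsmul_apply,
        AddMonoidHom.finsetSum_apply]
      rw [Finset.sum_congr rfl e3, hochAct_inc S _ _ (r' := k + q - 1) (by omega) (by omega),
        hochAct_inc S _ _ (r' := k + q - 1) (by omega) (by omega), DGProp.d_win _ _ _ _ hq]
      simp only [smul_add, smul_smul, Finset.smul_sum, ← sgn_add]
      have e0 : ∀ A B B' C C' : hochX X b r', B = B' → C = C' → A + B + C = A + C' + B' := by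
        rintro A B B' C C' rfl rfl
        abel
      apply e0
      · congr 1
        apply sgn_congr
        rw [← hk, ← hq]
        exact ⟨0, by ring⟩
      · refine Finset.sum_congr rfl fun i _ => ?_
        congr 1
        apply sgn_congr
        exact ⟨j * q - i * q, by ring⟩
    exact DFunLike.congr_fun this x

end AinfProp
end Hoch

section GrHom

variable {O : Type w} {X Y Z W : O → ℤ → AddCommGrpCat.{u}}

instance {s : ℤ} : AddCommGroup (GrHom X Y s) where
  add θ η a p q h := θ a p q h + η a p q h
  zero _ _ _ _ := 0
  neg θ a p q h := - θ a p q h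
  sub θ η a p q h := θ a p q h - η a p q h
  nsmul n θ a p q h := n • θ a p q h
  zsmul n θ a p q h := n • θ a p q h
  add_assoc _ _ _ := by funext; exact add_assoc _ _ _
  zero_add _ := by funext; exact zero_add _
  add_zero _ := by funext; exact add_zero _
  add_comm _ _ := by funext; exact add_comm _ _
  neg_add_cancel _ := by funext; exact neg_add_cancel _
  sub_eq_add_neg _ _ := by funext; exact sub_eq_add_neg _ _
  nsmul_zero _ := by funext; exact zero_nsmul _
  nsmul_succ _ _ := by funext; exact succ_nsmul _ _
  zsmul_zero' _ := by funext; exact zero_zsmul _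
  zsmul_succ' _ _ := by funext; exact SubNegMonoid.zsmul_succ' _ _
  zsmul_neg' _ _ := by funext; exact SubNegMonoid.zsmul_neg' _ _

lemma GrHom.add_apply {s : ℤ} (θ η : GrHom X Y s) (a : O) {p q : ℤ} (h : p + s = q) (x : X a p) :
    (θ + η) a p q h x = θ a p q h x + η a p q h x := rfl

lemma GrHom.neg_apply {s : ℤ} (θ : GrHom X Y s) (a : O) {p q : ℤ} (h : p + s = q) (x : X a p) :
    (-θ) a p q h x = - θ a p q h x := rfl

lemma GrHom.zsmul_apply {s : ℤ} (n : ℤ) (θ : GrHom X Y s) (a : O) {p q : ℤ} (h : p + s = q)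
    (x : X a p) : (n • θ) a p q h x = n • θ a p q h x := rfl

lemma GrHom.zero_apply {s : ℤ} (a : O) {p q : ℤ} (h : p + s = q)
    (x : X a p) : (0 : GrHom X Y s) a p q h x = 0 := rfl

lemma GrHom.ext {s : ℤ} {θ η : GrHom X Y s}
    (H : ∀ (a : O) (p q : ℤ) (h : p + s = q) (x : X a p), θ a p q h x = η a p q h x) : θ = η := by
  funext a p q h
  exact AddMonoidHom.ext (H a p q h)

/-- Composition of homogeneous maps, in diagrammatic order. -/
def GrHom.comp {s t r : ℤ} (h : s + t = r) : GrHom X Y s →+ GrHom Y Z t →+ GrHom X Z r :=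
  AddMonoidHom.mk' (fun θ => AddMonoidHom.mk'
    (fun η a p q hq => (η a (p + s) q (by omega)).comp (θ a p (p + s) rfl))
    (fun η η' => GrHom.ext fun _ _ _ _ _ => rfl))
    (fun θ θ' => by
      ext1 η
      exact GrHom.ext fun a p q h x => map_add (η a (p + s) q (by omega)) _ _)

/-- The identity map. -/
def GrHom.id (X : O → ℤ → AddCommGrpCat.{u}) : GrHom X X 0 := fun a p _ h =>
  (eqToHom (congrArg (X a) (by omega))).hom

/-- The differential `x (dθ) = (-1)^|x| (d (x θ) - (dx) θ)` of homogeneous maps, for which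
`d (x θ) = (dx) θ + (-1)^|x| x (dθ)`. -/
def GrHom.diff (dX : ∀ a p q, X a p →+ X a q) (dY : ∀ a p q, Y a p →+ Y a q) {s t : ℤ}
    (h : t + 1 = s) : GrHom X Y s →+ GrHom X Y t :=
  AddMonoidHom.mk' (fun θ a p q hq => sgn p •
    ((dY a (q + 1) q).comp (θ a p (q + 1) (by omega)) -
      (θ a (p - 1) q (by omega)).comp (dX a p (p - 1))))
    (fun θ θ' => by
      refine GrHom.ext fun a p q h x => ?_
      simp only [GrHom.add_apply, AddMonoidHom.zsmul_apply, AddMonoidHom.sub_apply,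
        AddMonoidHom.comp_apply, map_add]
      rw [← smul_add]
      congr 1
      abel)

lemma GrHom.comp_apply {s t r : ℤ} (h : s + t = r) (θ : GrHom X Y s) (η : GrHom Y Z t)
    (a : O) {p p' q : ℤ} (hp : p + s = p') (hp' : p' + t = q) (hq : p + r = q) (x : X a p) :
    GrHom.comp h θ η a p q hq x = η a p' q hp' (θ a p p' hp x) := by
  subst hp; rfl

lemma GrHom.id_apply (a : O) {p : ℤ} (h : p + 0 = p) (x : X a p) :
    GrHom.id X a p p h x = x := by
  simp [GrHom.id]

lemma GrHom.diff_apply (dX : ∀ a p q, X a p →+ X a q) (dY : ∀ a p q, Y a p →+ Y a q)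
    {s t : ℤ} (h : t + 1 = s) (θ : GrHom X Y s) (a : O) {p q p' q' : ℤ} (hq : p + t = q)
    (hp' : p' + 1 = p) (hq' : q + 1 = q') (x : X a p) :
    GrHom.diff dX dY h θ a p q hq x =
      sgn p • (dY a q' q (θ a p q' (by omega) x) - θ a p' q (by omega) (dX a p p' x)) := by
  obtain rfl : p' = p - 1 := by omega
  subst hq'
  rfl

lemma sgn_sub_one (p : ℤ) : sgn (p - 1) = - sgn p := by
  rw [sub_eq_add_neg, sgn_add, show sgn (-1) = -1 by simp [sgn], mul_neg_one]

lemma GrHom.d_apply (dX : ∀ a p q, X a p →+ X a q) (dY : ∀ a p q, Y a p →+ Y a q)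
    {s t : ℤ} (h : t + 1 = s) (θ : GrHom X Y s) (a : O) {p q p' q' : ℤ} (hq : p + t = q)
    (hp' : p' + 1 = p) (hq' : q + 1 = q') (x : X a p) :
    dY a q' q (θ a p q' (by omega) x) = θ a p' q (by omega) (dX a p p' x) +
      sgn p • GrHom.diff dX dY h θ a p q hq x := by
  rw [GrHom.diff_apply dX dY h θ a hq hp' hq', smul_smul, sgn_mul_self, one_smul]
  abel

lemma GrHom.diff_diff (dX : ∀ a p q, X a p →+ X a q) (dY : ∀ a p q, Y a p →+ Y a q)
    (hX : ∀ a p q r x, dX a q r (dX a p q x) = 0) (hY : ∀ a p q r x, dY a q r (dY a p q x) = 0)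
    {s t r : ℤ} (h : t + 1 = s) (h' : r + 1 = t) (θ : GrHom X Y s) :
    GrHom.diff dX dY h' (GrHom.diff dX dY h θ) = 0 := by
  refine GrHom.ext fun a p q hq x => ?_
  rw [GrHom.diff_apply dX dY h' _ a hq (p' := p - 1) (q' := q + 1) (by omega) (by omega),
    GrHom.diff_apply dX dY h _ a _ (p' := p - 1) (q' := q + 2) (by omega) (by omega),
    GrHom.diff_apply dX dY h _ a _ (p' := p - 2) (q' := q + 1) (by omega) (by omega),
    hX, map_zero, map_zsmul, map_sub, hY, sgn_sub_one]
  simp [GrHom.zero_apply]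

lemma GrHom.diff_comp (dX : ∀ a p q, X a p →+ X a q) (dY : ∀ a p q, Y a p →+ Y a q)
    (dZ : ∀ a p q, Z a p →+ Z a q)
    {s t r s' t' r' : ℤ} (h : s + t = r) (hs : s' + 1 = s) (ht : t' + 1 = t) (hr : r' + 1 = r)
    (θ : GrHom X Y s) (η : GrHom Y Z t) :
    GrHom.diff dX dZ hr (GrHom.comp h θ η) =
      GrHom.comp (by omega) (GrHom.diff dX dY hs θ) η +
        sgn s • GrHom.comp (by omega) θ (GrHom.diff dY dZ ht η) := by
  refine GrHom.ext fun a p q hq x => ?_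
  simp only [GrHom.add_apply, GrHom.zsmul_apply]
  rw [GrHom.diff_apply dX dZ hr _ a hq (p' := p - 1) (q' := q + 1) (by omega) (by omega),
    GrHom.comp_apply _ _ _ a (p' := p + s) (by omega) (by omega),
    GrHom.comp_apply _ _ _ a (p' := p + s') (by omega) (by omega),
    GrHom.comp_apply _ _ _ a (p' := p + s') (by omega) (by omega),
    GrHom.comp_apply _ _ _ a (p' := p + s) (by omega) (by omega),
    GrHom.diff_apply dX dY hs _ a _ (p' := p - 1) (q' := p + s) (by omega) (by omega),
    GrHom.diff_apply dY dZ ht _ a _ (p' := p + s') (q' := q + 1) (by omega) (by omega),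
    map_zsmul, map_sub, smul_smul, ← sgn_add, sgn_congr (p := s + (p + s)) (q := p) ⟨s, by ring⟩,
    ← smul_add]
  congr 1
  abel

lemma GrHom.id_comp {s : ℤ} (θ : GrHom X Y s) : GrHom.comp (zero_add s) (GrHom.id X) θ = θ := by
  refine GrHom.ext fun a p q hq x => ?_
  rw [GrHom.comp_apply _ _ _ a (add_zero p) hq, GrHom.id_apply]

lemma GrHom.comp_id {s : ℤ} (θ : GrHom X Y s) : GrHom.comp (add_zero s) θ (GrHom.id Y) = θ := by
  refine GrHom.ext fun a p q hq x => ?_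
  rw [GrHom.comp_apply _ _ _ a hq (add_zero q), GrHom.id_apply]

lemma GrHom.comp_assoc {p q r pq qr s : ℤ} (h₁ : p + q = pq) (h₂ : pq + r = s)
    (h₃ : q + r = qr) (h₄ : p + qr = s) (f : GrHom X Y p) (g : GrHom Y Z q) (k : GrHom Z W r) :
    GrHom.comp h₂ (GrHom.comp h₁ f g) k = GrHom.comp h₄ f (GrHom.comp h₃ g k) := by
  refine GrHom.ext fun a i j hij x => ?_
  rw [GrHom.comp_apply _ _ _ a (p' := i + pq) rfl (by omega),
    GrHom.comp_apply _ _ _ a (p' := i + p) rfl (by omega),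
    GrHom.comp_apply _ _ _ a (p' := i + p) rfl (by omega),
    GrHom.comp_apply _ _ _ a (p' := i + pq) (by omega) (by omega)]

end GrHom

section Hoch

variable {X Y : ℕ → ℤ → AddCommGrpCat.{u}}

/-- The underlying graded groups of the iterated Hochschild complex. -/
def hochIterX : ℕ → (ℕ → ℤ → AddCommGrpCat.{u}) → ℕ → ℤ → AddCommGrpCat.{u}
  | 0, X => X
  | n + 1, X => hochX (hochIterX n X)

/-- The map induced on iterated Hochschild complexes by a homogeneous map. -/
def hochIterMap {s : ℤ} (θ : GrHom X Y s) : ∀ n : ℕ, GrHom (hochIterX n X) (hochIterX n Y) s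
  | 0 => θ
  | n + 1 => hochMap (hochIterMap θ n)

namespace AinfProp

variable {E : AinfProp.{u}}

/-- The iterated Hochschild complex `C^n(Φ) = C(C^(n-1)(Φ))`, as a functor on `E`. -/
def hochIterStr (S : DGModule E.toDGCat X) : ∀ n : ℕ, DGModule E.toDGCat (hochIterX n X)
  | 0 => S
  | n + 1 => hochStr (hochIterStr S n)

lemma isNat_hochMap (S : DGModule E.toDGCat X) (T : DGModule E.toDGCat Y) {s : ℤ}
    (θ : GrHom X Y s) (hθ : GrHom.IsNat S T θ) : GrHom.IsNat (hochStr S) (hochStr T) (hochMap θ) := by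
  intro a b p q r p' r' h hp hr x f
  have : (hochMap θ b r r' hr).comp ((hochAct S h).flip f) =
      sgn (q * s) • ((hochAct T (p := p') (r := r') (by omega)).flip f).comp
        (hochMap θ a p p' hp) := by
    refine hoch_hom_ext fun j k hk x => ?_
    simp only [AddMonoidHom.comp_apply, AddMonoidHom.flip_apply, AddMonoidHom.zsmul_apply]
    rw [hochAct_inc S h hk (r' := k + q) (by omega) rfl, map_zsmul,
      hochMap_inc θ hr (q' := k + q + s) _ _ (by omega) rfl,
      hθ rfl rfl, hochMap_inc θ hp (q' := k + s) _ _ (by omega) rfl, map_zsmul (hochAct T _),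
      AddMonoidHom.zsmul_apply, hochAct_inc T _ _ (r' := k + q + s) (by omega) (by omega)]
    simp only [map_zsmul, smul_smul, ← sgn_add]
    congr 2
    ring
  exact DFunLike.congr_fun this x

lemma diff_hochMap (S : DGModule E.toDGCat X) (T : DGModule E.toDGCat Y) {s t : ℤ}
    (h : t + 1 = s) (θ : GrHom X Y s) (hθ : GrHom.IsNat S T θ) :
    GrHom.diff (hochD S) (hochD T) h (hochMap θ) = hochMap (GrHom.diff S.d T.d h θ) := by
  funext m p q hq
  refine hoch_hom_ext fun j k hk x => ?_
  rw [GrHom.diff_apply _ _ h _ m hq (p' := p - 1) (q' := q + 1) (by omega) (by omega),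
    hochMap_inc θ _ (q' := k + s) _ _ (by omega) rfl,
    hochMap_inc _ _ (q' := k + t) _ _ (by omega) rfl, map_zsmul,
    hochD_inc T (p := q + 1) rfl (q' := k + t) _ (by omega), hochD_inc S (q := p - 1) (by omega) (q' := k - 1) _ (by omega),
    GrHom.diff_apply _ _ h _ _ _ (p' := k - 1) (q' := k + s) (by omega) (by omega),
    map_add, map_zsmul, map_sum, hochMap_inc θ _ (q' := k + t) _ _ (by omega) (by omega)]
  have e : ∀ i ∈ Finset.range j, hochMap θ m (p - 1) q (by omega)
      (hochInc i (p' := p - 1 - i) (by omega) (S.act (by omega) x (E.hochOp m j i))) =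
      sgn (i * s) • sgn ((j - i - 1) * s) • hochInc i (p' := q - i) (by omega)
        (T.act (by omega) (θ _ k (k + s) rfl x) (E.hochOp m j i)) := by
    intro i _
    rw [hochMap_inc θ _ (q' := q - i) _ _ (by omega) (by omega), hθ _ rfl, map_zsmul]
    congr 3
    push_cast
    ring
  rw [Finset.sum_congr rfl e]
  simp only [smul_add, smul_sub, Finset.smul_sum, smul_smul, ← sgn_add, map_sub, map_zsmul]
  have e0 : ∀ A A' B B' C C' : hochX Y m q, A = A' → B = B' → C = C' →
      A + B - (C + B') = A' - C' := by
    rintro A A' B B' C C' rfl rfl rfl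
    abel
  apply e0
  · congr 1
    apply sgn_congr
    rw [← h, ← hk]
    exact ⟨j, by ring⟩
  · refine Finset.sum_congr rfl fun i _ => ?_
    congr 1
    apply sgn_congr
    exact ⟨s, by ring⟩
  · congr 1
    apply sgn_congr
    rw [← h, ← hk]
    exact ⟨j, by ring⟩

end AinfProp
end Hoch

lemma GrHom.isNat_diff {O : Type w} {A : DGCat.{u} O} {X Y : O → ℤ → AddCommGrpCat.{u}}
    (S : DGModule A X) (T : DGModule A Y) {s t : ℤ} (h : t + 1 = s) (θ : GrHom X Y s)
    (hθ : GrHom.IsNat S T θ) : GrHom.IsNat S T (GrHom.diff S.d T.d h θ) := by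
  intro a b p q r p' r' hr hp hr' x f
  rw [GrHom.diff_apply S.d T.d h θ b hr' (p' := r - 1) (q' := r' + 1) (by omega) rfl,
    GrHom.diff_apply S.d T.d h θ a hp (p' := p - 1) (q' := p' + 1) (by omega) rfl,
    hθ hr (p' := p' + 1) (by omega),
    S.d_act hr (p' := p - 1) (q' := q - 1) (by omega) (by omega) (by omega), map_zsmul,
    T.d_act _ (p' := p') (q' := q - 1) (by omega) (by omega) (by omega), map_add, map_zsmul,
    hθ _ (p' := p') (by omega), hθ _ (p' := p' + 1) (by omega), map_zsmul (T.act _),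
    AddMonoidHom.zsmul_apply, map_sub, AddMonoidHom.sub_apply]
  simp only [smul_add, smul_sub, smul_smul, ← sgn_add]
  have e0 : ∀ A A' B B' C C' : Y b r', A = A' → B = B' → C = C' →
      A + B - (C + B') = A' - C' := by
    rintro A A' B B' C C' rfl rfl rfl
    abel
  apply e0
  all_goals
    congr 1
    apply sgn_congr
    rw [← h, ← hr]
  · exact ⟨q, by ring⟩
  · refine ⟨t + 1, ?_⟩
    obtain rfl : p' = p + t := hp.symm
    ring
  · exact ⟨q, by ring⟩

/-- The differential of a natural transformation. -/
def DGTrans.diff {O : Type w} {A : DGCat.{u} O} {Φ Ψ : DGFunctor A} {s t : ℤ} (h : t + 1 = s)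
    (θ : DGTrans Φ Ψ s) : DGTrans Φ Ψ t where
  app := GrHom.diff Φ.str.d Ψ.str.d h θ.app
  naturality := GrHom.isNat_diff _ _ h _ θ.naturality

/-- Restriction along a dg-functor that is the identity on objects. -/
def DGModule.pullback {O : Type w} {A B : DGCat.{u} O} (F : A.Functor B)
    {X : O → ℤ → AddCommGrpCat.{u}} (S : DGModule B X) : DGModule A X where
  d := S.d
  shape := S.shape
  d_d := S.d_d
  act {a b p q r} h := (S.act h).compl₂ ((F.map a b).f q).hom
  act_id {a p} x := by
    have := F.map_id a
    simp [this, S.act_id]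
  act_comp h₁ h₂ h₃ h₄ x f g := by
    have := F.map_comp h₃ f g
    simp [this, S.act_comp h₁ h₂ h₃ h₄]
  d_act {a b _ q _ _ q' _} h hp hq hr x f := by
    have : (B.hom a b).d q q' ((F.map a b).f q f) = (F.map a b).f q' ((A.hom a b).d q q' f) := by
      have := (F.map a b).comm q q'
      exact congrArg (fun k => k.hom f) this
    simp only [AddMonoidHom.compl₂_apply]
    rw [S.d_act h hp hq hr, this]

/-- Restriction of a dg-functor `B ⟶ Ch` along a dg-functor `A ⟶ B`. -/
def DGFunctor.pullback {O : Type w} {A B : DGCat.{u} O} (F : A.Functor B) (Φ : DGFunctor B) :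
    DGFunctor A where
  X := Φ.X
  str := Φ.str.pullback F

/-- Restriction of a natural transformation. -/
def DGTrans.pullback {O : Type w} {A B : DGCat.{u} O} (F : A.Functor B) {Φ Ψ : DGFunctor B}
    {s : ℤ} (θ : DGTrans Φ Ψ s) : DGTrans (Φ.pullback F) (Ψ.pullback F) s where
  app := θ.app
  naturality _ _ _ _ _ _ _ h hp hr x _ := θ.naturality h hp hr x _

namespace AinfProp

/-- A dg-functor between props with `A_∞`-multiplication that is the identity on objects and
commutes with the functors from `A_∞`, that is, preserves the morphisms `id_a ⊗ m_s ⊗ id_b` and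
`id_a ⊗ σ ⊗ id_b`, for `σ` a symmetry, which generate the image of `A_∞`. Every symmetric
monoidal such functor that preserves the multiplications `m_s` is an example. -/
structure Hom (E E' : AinfProp.{u}) extends DGCat.Functor E.toDGCat E'.toDGCat where
  map_mul (a b : ℕ) {s n m : ℕ} {p : ℤ} (hs : 2 ≤ s) (hp : p + 2 = s) (hn : a + s + b = n)
    (hm : a + 1 + b = m) :
    (map n m).f p (E.win a b hn hm (E.mul s p hs hp)) = E'.win a b hn hm (E'.mul s p hs hp)
  map_braid (a b : ℕ) {s t c c' n m : ℕ} (h : s + t = c) (h' : t + s = c') (hn : a + c + b = n)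
    (hm : a + c' + b = m) :
    (map n m).f 0 (E.win a b hn hm (E.braid s t h h')) = E'.win a b hn hm (E'.braid s t h h')

namespace Hom

variable {E E' : AinfProp.{u}} (φ : Hom E E')

lemma map_block (a b : ℕ) {n k N K : ℕ} (hN : a + n + b = N) (hK : a + k + b = K) (i : ℕ) :
    (φ.map N K).f _ (E.win a b hN hK (E.block n k i)) = E'.win a b hN hK (E'.block n k i) := by
  unfold block
  split_ifs
  · rw [DGProp.win_win i (k - 1 - i) a b (a'' := a + i) (b'' := k - 1 - i + b) _ _ _ _ rfl rfl
      (by omega) (by omega), φ.map_mul, ← DGProp.win_win i (k - 1 - i) a b]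
    · rfl
    · rfl
  · simp only [map_zero]

lemma map_cyc (a b : ℕ) {n k N K : ℕ} (hN : a + n + b = N) (hK : a + k + b = K) (i : ℕ) :
    (φ.map N K).f _ (E.win a b hN hK (E.cyc n k i)) = E'.win a b hN hK (E'.cyc n k i) := by
  unfold cyc
  split_ifs
  · rw [map_zsmul, map_zsmul, map_zsmul, φ.map_block]
  · rw [map_zsmul, map_zsmul, map_zsmul, ← DGProp.comp_win _ _ _ hN hN hK,
      ← DGProp.comp_win _ _ _ hN hN hK, φ.map_comp, φ.map_block, φ.map_braid]
  · simp only [map_zero]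

lemma map_hochTerm (a b : ℕ) {n k N K : ℕ} (hN : a + n + b = N) (hK : a + k + b = K) :
    (φ.map N K).f _ (E.win a b hN hK (E.hochTerm n k)) = E'.win a b hN hK (E'.hochTerm n k) := by
  unfold hochTerm
  simp only [map_neg, map_sum, φ.map_cyc]

/-- Structures over `E` and `E'` with the same differentials, on which the terms of the
Hochschild differentials act in the same way. -/
def Agree {X : ℕ → ℤ → AddCommGrpCat.{u}} (S : DGModule E.toDGCat X)
    (S' : DGModule E'.toDGCat X) : Prop :=
  S.d = S'.d ∧ ∀ (a b : ℕ) {n k N K : ℕ} (hN : a + n + b = N) (hK : a + k + b = K) {p r : ℤ}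
    (h : p + ((n : ℤ) - k - 1) = r) (x : X N p),
    S.act h x (E.win a b hN hK (E.hochTerm n k)) = S'.act h x (E'.win a b hN hK (E'.hochTerm n k))

lemma agree_pullback {X : ℕ → ℤ → AddCommGrpCat.{u}} (S : DGModule E'.toDGCat X) :
    Agree (E := E) (S.pullback φ.toFunctor) S :=
  ⟨rfl, fun a b _ _ _ _ hN hK _ _ h x => congrArg (S.act h x) (φ.map_hochTerm a b hN hK)⟩

lemma Agree.hochStr {X : ℕ → ℤ → AddCommGrpCat.{u}} {S : DGModule E.toDGCat X}
    {S' : DGModule E'.toDGCat X} (H : Agree S S') : Agree (hochStr S) (hochStr S') := by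
  refine ⟨?_, fun a b n k N K hN hK p r h x => ?_⟩
  · funext m p q
    change hochD S m p q = hochD S' m p q
    by_cases hq : q + 1 = p
    · refine hoch_hom_ext fun j p' hp x => ?_
      rw [hochD_inc _ hq _ (q' := p' - 1) (by omega), hochD_inc _ hq _ (q' := p' - 1) (by omega),
        H.1]
      congr 2
      refine Finset.sum_congr rfl fun i _ => ?_
      congr 1
      exact H.2 ..
    · simp [hochD, hq]
  · have : (hochAct S h).flip (E.win a b hN hK (E.hochTerm n k)) =
        (hochAct S' h).flip (E'.win a b hN hK (E'.hochTerm n k)) := by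
      refine hoch_hom_ext fun j p' hp x => ?_
      simp only [AddMonoidHom.flip_apply]
      rw [hochAct_inc _ h hp (r' := r - j) (by omega) (by omega),
        hochAct_inc _ h hp (r' := r - j) (by omega) (by omega),
        DGProp.win_win a b (j + 1) 0 (a'' := j + 1 + a) (b'' := b) _ _ _ _ rfl (add_zero b)
          (by omega) (by omega),
        DGProp.win_win a b (j + 1) 0 (a'' := j + 1 + a) (b'' := b) _ _ _ _ rfl (add_zero b)
          (by omega) (by omega), H.2]
    exact DFunLike.congr_fun this x

lemma Agree.hochIterStr {X : ℕ → ℤ → AddCommGrpCat.{u}} {S : DGModule E.toDGCat X}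
    {S' : DGModule E'.toDGCat X} (H : Agree S S') :
    ∀ n : ℕ, Agree (hochIterStr S n) (hochIterStr S' n)
  | 0 => H
  | n + 1 => (H.hochIterStr n).hochStr

end Hom

variable (E : AinfProp.{u})

/-- The graded groups `C^n(Φ)(m)` underlying the functor `Φ ↦ C^n(Φ)(m)`. -/
def opX (n m : ℕ) (Φ : DGFunctor E.toDGCat) (p : ℤ) : AddCommGrpCat.{u} := hochIterX n Φ.X m p

/-- The differential of `C^n(Φ)(m)`. -/
def opD (n m : ℕ) (Φ : DGFunctor E.toDGCat) (p q : ℤ) : E.opX n m Φ p →+ E.opX n m Φ q :=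
  (hochIterStr Φ.str n).d m p q

/-- The action of a natural transformation on `C^n(-)(m)`. -/
def opMap (n m : ℕ) {Φ Ψ : DGFunctor E.toDGCat} {s : ℤ} (θ : DGTrans Φ Ψ s) {p q : ℤ}
    (h : p + s = q) : E.opX n m Φ p →+ E.opX n m Ψ q :=
  hochIterMap θ.app n m p q h

variable {E}

lemma isNat_hochIterMap {X Y : ℕ → ℤ → AddCommGrpCat.{u}} (S : DGModule E.toDGCat X)
    (T : DGModule E.toDGCat Y) {s : ℤ} (θ : GrHom X Y s) (hθ : GrHom.IsNat S T θ) :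
    ∀ n : ℕ, GrHom.IsNat (hochIterStr S n) (hochIterStr T n) (hochIterMap θ n)
  | 0 => hθ
  | n + 1 => isNat_hochMap _ _ _ (isNat_hochIterMap S T θ hθ n)

lemma diff_hochIterMap {X Y : ℕ → ℤ → AddCommGrpCat.{u}} (S : DGModule E.toDGCat X)
    (T : DGModule E.toDGCat Y) {s t : ℤ} (h : t + 1 = s) (θ : GrHom X Y s)
    (hθ : GrHom.IsNat S T θ) :
    ∀ n : ℕ, GrHom.diff (hochIterStr S n).d (hochIterStr T n).d h (hochIterMap θ n) =
      hochIterMap (GrHom.diff S.d T.d h θ) n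
  | 0 => rfl
  | n + 1 => by
    exact (diff_hochMap _ _ h _ (isNat_hochIterMap S T θ hθ n)).trans
      (congrArg hochMap (diff_hochIterMap S T h θ hθ n))

lemma opD_opD (n m : ℕ) (Φ : DGFunctor E.toDGCat) (p q r : ℤ) (x : E.opX n m Φ p) :
    E.opD n m Φ q r (E.opD n m Φ p q x) = 0 :=
  (hochIterStr Φ.str n).d_d m p q r x

lemma opD_opMap (n m : ℕ) {Φ Ψ : DGFunctor E.toDGCat} {s t : ℤ} (ht : t + 1 = s)
    (θ : DGTrans Φ Ψ s) {p q p' q' : ℤ} (hq' : p + s = q') (hp' : p' + 1 = p) (hq : q + 1 = q')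
    (x : E.opX n m Φ p) :
    E.opD n m Ψ q' q (E.opMap n m θ hq' x) =
      E.opMap n m θ (by omega) (E.opD n m Φ p p' x) +
        sgn p • E.opMap n m (θ.diff ht) (by omega) x := by
  have := GrHom.d_apply (hochIterStr Φ.str n).d (hochIterStr Ψ.str n).d ht
    (hochIterMap θ.app n) m (p := p) (q := q) (by omega) hp' hq x
  rw [diff_hochIterMap _ _ ht _ θ.naturality] at this
  exact this

/-- Naturality of a family of homogeneous maps `C^n₁(Φ)(m₁) ⟶ C^n₂(Φ)(m₂)` of degree `p`, with
respect to the natural transformations `θ : Φ ⟶ Ψ` of all degrees: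
`(x θ) ν_Ψ = (-1)^(|θ||ν|) (x ν_Φ) θ`. -/
def IsNatOp {n₁ m₁ n₂ m₂ : ℕ} {p : ℤ} (ν : GrHom (E.opX n₁ m₁) (E.opX n₂ m₂) p) : Prop :=
  ∀ ⦃Φ Ψ : DGFunctor E.toDGCat⦄ ⦃s : ℤ⦄ (θ : DGTrans Φ Ψ s) ⦃q r q' r' : ℤ⦄ (h : q + p = r)
    (hq : q + s = q') (hr : q' + p = r') (x : E.opX n₁ m₁ Φ q),
    ν Ψ q' r' hr (E.opMap n₁ m₁ θ hq x) =
      sgn (s * p) • E.opMap n₂ m₂ θ (by omega) (ν Φ q r h x)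

lemma isNatOp_diff {n₁ m₁ n₂ m₂ : ℕ} {p t : ℤ} (ht : t + 1 = p)
    {ν : GrHom (E.opX n₁ m₁) (E.opX n₂ m₂) p} (hν : IsNatOp ν) :
    IsNatOp (GrHom.diff (E.opD n₁ m₁) (E.opD n₂ m₂) ht ν) := by
  intro Φ Ψ s θ q r q' r' h hq hr x
  have hs : s - 1 + 1 = s := by omega
  rw [GrHom.diff_apply _ _ ht ν Ψ hr (p' := q' - 1) (q' := r' + 1) (by omega) rfl,
    GrHom.diff_apply _ _ ht ν Φ h (p' := q - 1) (q' := r + 1) (by omega) rfl,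
    hν θ (q := q) (r := r + 1) (by omega),
    opD_opMap n₁ m₁ hs θ _ (p' := q - 1) (by omega) (by omega), map_add, map_zsmul, map_zsmul,
    opD_opMap n₂ m₂ hs θ _ (p' := r) rfl (by omega),
    hν θ (q := q - 1) (r := r) (by omega), hν (θ.diff hs) (q := q) (r := r + 1) (by omega),
    map_zsmul, map_sub]
  simp only [smul_add, smul_sub, smul_smul, ← sgn_add]
  have e0 : ∀ A A' B B' C C' : E.opX n₂ m₂ Ψ r', A = A' → B = B' → C = C' →
      A + B - (C + B') = A' - C' := by
    rintro A A' B B' C C' rfl rfl rfl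
    abel
  apply e0
  all_goals
    congr 1
    apply sgn_congr
    rw [← ht, ← hq]
  · exact ⟨s, by ring⟩
  · refine ⟨t + 1, ?_⟩
    obtain rfl : r = q + t := h.symm
    ring
  · exact ⟨s, by ring⟩

lemma isNatOp_id (n m : ℕ) : IsNatOp (GrHom.id (E.opX n m)) := by
  intro Φ Ψ s θ q r q' r' h hq hr x
  obtain rfl : q = r := by omega
  obtain rfl : q' = r' := by omega
  rw [GrHom.id_apply, GrHom.id_apply, mul_zero, sgn_zero, one_smul]

lemma isNatOp_comp {n₁ m₁ n₂ m₂ n₃ m₃ : ℕ} {p q r : ℤ} (h : p + q = r)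
    {ν : GrHom (E.opX n₁ m₁) (E.opX n₂ m₂) p} {μ : GrHom (E.opX n₂ m₂) (E.opX n₃ m₃) q}
    (hν : IsNatOp ν) (hμ : IsNatOp μ) : IsNatOp (GrHom.comp h ν μ) := by
  intro Φ Ψ s θ i j i' j' hj hi hj' x
  rw [GrHom.comp_apply _ _ _ Ψ (p' := i' + p) rfl (by omega),
    GrHom.comp_apply _ _ _ Φ (p' := i + p) rfl (by omega), hν θ (r := i + p) rfl hi, map_zsmul,
    hμ θ (r := j) (by omega), smul_smul, ← sgn_add, ← mul_add]
  congr 3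

variable (E)

/-- The complex of natural transformations from `C^n₁(-)(m₁)` to `C^n₂(-)(m₂)`. -/
def opHom (n₁ m₁ n₂ m₂ : ℕ) (p : ℤ) : AddSubgroup (GrHom (E.opX n₁ m₁) (E.opX n₂ m₂) p) where
  carrier := {ν | IsNatOp ν}
  zero_mem' Φ Ψ s θ q r q' r' h hq hr x := by simp [GrHom.zero_apply]
  add_mem' hν hμ Φ Ψ s θ q r q' r' h hq hr x := by
    rw [GrHom.add_apply, GrHom.add_apply, hν θ h, hμ θ h, map_add, smul_add]
  neg_mem' hν Φ Ψ s θ q r q' r' h hq hr x := by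
    rw [GrHom.neg_apply, GrHom.neg_apply, hν θ h, map_neg, smul_neg]

/-- The differential of the complex of natural transformations. -/
def opHomD (n₁ m₁ n₂ m₂ : ℕ) (p q : ℤ) : E.opHom n₁ m₁ n₂ m₂ p →+ E.opHom n₁ m₁ n₂ m₂ q :=
  if h : q + 1 = p then
    ((GrHom.diff (E.opD n₁ m₁) (E.opD n₂ m₂) h).comp
      (E.opHom n₁ m₁ n₂ m₂ p).subtype).codRestrict (E.opHom n₁ m₁ n₂ m₂ q)
      fun ν => isNatOp_diff h ν.2
  else 0

lemma opHomD_coe {n₁ m₁ n₂ m₂ : ℕ} {p q : ℤ} (h : q + 1 = p) (ν : E.opHom n₁ m₁ n₂ m₂ p) :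
    (E.opHomD n₁ m₁ n₂ m₂ p q ν : GrHom (E.opX n₁ m₁) (E.opX n₂ m₂) q) =
      GrHom.diff (E.opD n₁ m₁) (E.opD n₂ m₂) h ν.1 := by
  rw [opHomD, dif_pos h]
  rfl

variable {E} in
/-- The composition of natural transformations. -/
def opComp {n₁ m₁ n₂ m₂ n₃ m₃ : ℕ} {p q r : ℤ} (h : p + q = r) :
    E.opHom n₁ m₁ n₂ m₂ p →+ E.opHom n₂ m₂ n₃ m₃ q →+ E.opHom n₁ m₁ n₃ m₃ r :=
  AddMonoidHom.mk' (fun ν => AddMonoidHom.mk'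
    (fun μ => ⟨GrHom.comp h ν.1 μ.1, isNatOp_comp h ν.2 μ.2⟩)
    (fun μ μ' => Subtype.ext (map_add (GrHom.comp h ν.1) μ.1 μ'.1)))
    (fun ν ν' => AddMonoidHom.ext fun μ => Subtype.ext
      (DFunLike.congr_fun (map_add (GrHom.comp h) ν.1 ν'.1) μ.1))

lemma opHomD_opComp {n₁ m₁ n₂ m₂ n₃ m₃ : ℕ} {p q r p' q' r' : ℤ} (h : p + q = r)
    (hp : p' + 1 = p) (hq : q' + 1 = q) (hr : r' + 1 = r) (ν : E.opHom n₁ m₁ n₂ m₂ p)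
    (μ : E.opHom n₂ m₂ n₃ m₃ q) :
    E.opHomD n₁ m₁ n₃ m₃ r r' (opComp h ν μ) =
      opComp (by omega) (E.opHomD n₁ m₁ n₂ m₂ p p' ν) μ +
        sgn p • opComp (by omega) ν (E.opHomD n₂ m₂ n₃ m₃ q q' μ) := by
  apply Subtype.ext
  refine (opHomD_coe E hr _).trans ((GrHom.diff_comp (E.opD n₁ m₁) (E.opD n₂ m₂) (E.opD n₃ m₃)
    h hp hq hr ν.1 μ.1).trans ?_)
  rw [← opHomD_coe E hp, ← opHomD_coe E hq]
  rfl

/-- The dg-category of formal operations: its objects are the pairs `(n, m)`, standing for the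
dg-functors `Φ ↦ C^n(Φ)(m)`, and its morphisms are the complexes of natural transformations. -/
def formalOps : DGCat.{u + 1} (ℕ × ℕ) where
  hom a b :=
    { X := fun p => AddCommGrpCat.of (E.opHom a.1 a.2 b.1 b.2 p)
      d := fun p q => AddCommGrpCat.ofHom (E.opHomD a.1 a.2 b.1 b.2 p q)
      shape := fun p q h => by
        have h : ¬ q + 1 = p := h
        rw [opHomD, dif_neg h]
        rfl
      d_comp_d' := fun p q r h h' => by
        have h : q + 1 = p := h
        have h' : r + 1 = q := h'
        refine AddCommGrpCat.hom_ext (AddMonoidHom.ext fun ν => Subtype.ext ?_)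
        change (E.opHomD a.1 a.2 b.1 b.2 q r (E.opHomD a.1 a.2 b.1 b.2 p q ν)).1 = 0
        rw [opHomD_coe _ h', opHomD_coe _ h]
        exact GrHom.diff_diff _ _ (opD_opD a.1 a.2) (opD_opD b.1 b.2) h h' ν.1 }
  comp h := opComp h
  id a := ⟨GrHom.id _, isNatOp_id a.1 a.2⟩
  id_comp f := Subtype.ext (GrHom.id_comp _)
  comp_id f := Subtype.ext (GrHom.comp_id _)
  assoc h₁ h₂ h₃ h₄ f g k := Subtype.ext (GrHom.comp_assoc h₁ h₂ h₃ h₄ _ _ _)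
  d_comp h hp hq hr f g := E.opHomD_opComp h hp hq hr f g

variable {E}

namespace Hom

variable {E E' : AinfProp.{u}} (φ : Hom E E')

/-- The family `Φ' ↦ ν_(φ^*Φ')`: since `C^n(φ^*Φ')(m) = C^n(Φ')(m)`, it is a family of maps
`C^n₁(Φ')(m₁) ⟶ C^n₂(Φ')(m₂)`. -/
def restrict {n₁ m₁ n₂ m₂ : ℕ} {p : ℤ} (ν : GrHom (E.opX n₁ m₁) (E.opX n₂ m₂) p) :
    GrHom (E'.opX n₁ m₁) (E'.opX n₂ m₂) p :=
  fun Φ => ν (Φ.pullback φ.toFunctor)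

lemma opD_pullback (n m : ℕ) (Φ : DGFunctor E'.toDGCat) :
    E.opD n m (Φ.pullback φ.toFunctor) = E'.opD n m Φ := by
  funext p q
  exact congrFun (congrFun (congrFun ((φ.agree_pullback Φ.str).hochIterStr n).1 m) p) q

lemma isNatOp_restrict {n₁ m₁ n₂ m₂ : ℕ} {p : ℤ} {ν : GrHom (E.opX n₁ m₁) (E.opX n₂ m₂) p}
    (hν : IsNatOp ν) : IsNatOp (φ.restrict ν) :=
  fun _ _ _ θ _ _ _ _ h hq hr x => hν (θ.pullback φ.toFunctor) h hq hr x

lemma restrict_diff {n₁ m₁ n₂ m₂ : ℕ} {p t : ℤ} (h : t + 1 = p)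
    (ν : GrHom (E.opX n₁ m₁) (E.opX n₂ m₂) p) :
    φ.restrict (GrHom.diff (E.opD n₁ m₁) (E.opD n₂ m₂) h ν) =
      GrHom.diff (E'.opD n₁ m₁) (E'.opD n₂ m₂) h (φ.restrict ν) := by
  refine GrHom.ext fun Φ q r hr x => ?_
  have h₁ := φ.opD_pullback n₁ m₁ Φ
  have h₂ := φ.opD_pullback n₂ m₂ Φ
  rw [GrHom.diff_apply _ _ h _ Φ hr (p' := q - 1) (q' := r + 1) (by omega) rfl, ← h₁, ← h₂]
  rfl

/-- The map `ν ↦ (Φ' ↦ ν_(φ^*Φ'))` on natural transformations. -/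
def opRestrict (n₁ m₁ n₂ m₂ : ℕ) (p : ℤ) :
    E.opHom n₁ m₁ n₂ m₂ p →+ E'.opHom n₁ m₁ n₂ m₂ p where
  toFun ν := ⟨φ.restrict ν.1, φ.isNatOp_restrict ν.2⟩
  map_zero' := rfl
  map_add' _ _ := rfl

lemma opHomD_opRestrict {n₁ m₁ n₂ m₂ : ℕ} {p q : ℤ} (h : q + 1 = p)
    (ν : E.opHom n₁ m₁ n₂ m₂ p) :
    E'.opHomD n₁ m₁ n₂ m₂ p q (φ.opRestrict n₁ m₁ n₂ m₂ p ν) =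
      φ.opRestrict n₁ m₁ n₂ m₂ q (E.opHomD n₁ m₁ n₂ m₂ p q ν) := by
  apply Subtype.ext
  refine (opHomD_coe E' h _).trans ((φ.restrict_diff h ν.1).symm.trans ?_)
  rw [← opHomD_coe E h]
  rfl

/-- The dg-functor between the dg-categories of formal operations that is induced by `φ`. It is
the identity on objects, and takes a natural transformation `ν` to the natural transformation
`Φ' ↦ ν_(φ^*Φ')`. -/
def mapFormalOps : DGCat.Functor E.formalOps E'.formalOps where
  map a b :=
    { f := fun p => AddCommGrpCat.ofHom (φ.opRestrict a.1 a.2 b.1 b.2 p)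
      comm' := fun _ _ h =>
        AddCommGrpCat.hom_ext (AddMonoidHom.ext fun ν => φ.opHomD_opRestrict h ν) }
  map_id _ := rfl
  map_comp _ _ _ := rfl

end Hom

end AinfProp

/-!
By the Yoneda lemma, natural transformations `Φ(a) ⟶ C^n(Φ)(m)` form the complex `C^n(E(a, -))(m)`.
The Hochschild complex is a direct sum on which the part of the differential lowering the index
`n` of `l_n` is strictly triangular, so `C` preserves quasi-isomorphisms, and hence
`C^n(E(a, -))(m) ⟶ C^n(E'(a, -))(m)` is one. A natural transformation out of `C^{n+1}(-)(m)` is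
a family of natural transformations out of `C^n(-)(j + 1 + m)`, one for each `j`; the differential
of the product is again triangular with the differentials of the factors on the diagonal, and
induction on `n` reduces everything to the Yoneda case. Quasi-isomorphisms are detected by the
exactness of the mapping cone, which can be checked on the diagonal of a triangular map: by descent
along the finite support for direct sums, by successive approximation for products.
-/

section Triangular

variable {ι : Type*} {G G' : ι → Type*} [∀ j, AddCommGroup (G j)] [∀ j, AddCommGroup (G' j)]
  {K K' : Type*} [AddCommGroup K] [AddCommGroup K']

/-- The maps `π j` exhibit `K` as the product of the groups `G j`. -/
structure IsProductCoord (π : ∀ j, K →+ G j) : Prop where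
  ext : ∀ x, (∀ j, π j x = 0) → x = 0
  exists_eq : ∀ g : ∀ j, G j, ∃ x, ∀ j, π j x = g j

/-- The maps `π j` exhibit `K` as the direct sum of the groups `G j`. -/
structure IsSumCoord (π : ∀ j, K →+ G j) : Prop where
  ext : ∀ x, (∀ j, π j x = 0) → x = 0
  finite : ∀ x, {j | π j x ≠ 0}.Finite
  exists_single : ∀ j (g : G j), ∃ x, π j x = g ∧ ∀ i, i ≠ j → π i x = 0

/-- With respect to the coordinates `π` and `π'`, the matrix of `δ` is triangular with diagonal
entries `ε j`: its entry from `i` to `j` vanishes unless `i = j` or `r i j`. The condition is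
stated on elements, so that it makes sense for infinite products as well. -/
def IsTriangular (r : ι → ι → Prop) (π : ∀ j, K →+ G j) (π' : ∀ j, K' →+ G' j)
    (δ : K →+ K') (ε : ∀ j, G j →+ G' j) : Prop :=
  ∀ x j, (∀ i, r i j → π i x = 0) → π' j (δ x) = ε j (π j x)

lemma IsProductCoord.exists_single {π : ∀ j, K →+ G j} (hπ : IsProductCoord π) (j : ι) (g : G j) :
    ∃ x, π j x = g ∧ ∀ i, i ≠ j → π i x = 0 := by
  classical
  obtain ⟨x, hx⟩ := hπ.exists_eq (Pi.single j g)
  exact ⟨x, by rw [hx, Pi.single_eq_same], fun i hi => by rw [hx, Pi.single_eq_of_ne hi]⟩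

lemma IsProductCoord.prodMap {π : ∀ j, K →+ G j} {π' : ∀ j, K' →+ G' j} (hπ : IsProductCoord π)
    (hπ' : IsProductCoord π') : IsProductCoord fun j => (π j).prodMap (π' j) where
  ext x hx := Prod.ext (hπ.ext _ fun j => congrArg Prod.fst (hx j))
    (hπ'.ext _ fun j => congrArg Prod.snd (hx j))
  exists_eq g := by
    obtain ⟨x, hx⟩ := hπ.exists_eq fun j => (g j).1
    obtain ⟨y, hy⟩ := hπ'.exists_eq fun j => (g j).2
    exact ⟨(x, y), fun j => Prod.ext (hx j) (hy j)⟩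

lemma IsSumCoord.prodMap {π : ∀ j, K →+ G j} {π' : ∀ j, K' →+ G' j} (hπ : IsSumCoord π)
    (hπ' : IsSumCoord π') : IsSumCoord fun j => (π j).prodMap (π' j) where
  ext x hx := Prod.ext (hπ.ext _ fun j => congrArg Prod.fst (hx j))
    (hπ'.ext _ fun j => congrArg Prod.snd (hx j))
  finite x := ((hπ.finite x.1).union (hπ'.finite x.2)).subset fun j hj => by
    by_contra h
    simp only [Set.mem_union, Set.mem_ofPred_eq, not_or, not_not] at h
    exact hj (Prod.ext h.1 h.2)
  exists_single j g := by
    obtain ⟨x, hx, hx'⟩ := hπ.exists_single j g.1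
    obtain ⟨y, hy, hy'⟩ := hπ'.exists_single j g.2
    exact ⟨(x, y), Prod.ext hx hy, fun i hi => Prod.ext (hx' i hi) (hy' i hi)⟩

lemma IsTriangular.map_eq_zero {r : ι → ι → Prop} {π : ∀ j, K →+ G j} {π' : ∀ j, K' →+ G' j}
    {δ : K →+ K'} {ε : ∀ j, G j →+ G' j} (h : IsTriangular r π π' δ ε) {x : K} {j : ι}
    (hx : ∀ i, r i j → π i x = 0) (hj : π j x = 0) : π' j (δ x) = 0 := by
  rw [h x j hx, hj, map_zero]

end Triangular

section TriangularExact

variable {K₁ K₂ K₃ : Type*} [AddCommGroup K₁] [AddCommGroup K₂] [AddCommGroup K₃]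

lemma IsTriangular.exists_sub_eq_zero {ι : Type*} {G₁ G₂ G₃ : ι → Type*}
    [∀ j, AddCommGroup (G₁ j)] [∀ j, AddCommGroup (G₂ j)] [∀ j, AddCommGroup (G₃ j)]
    {r : ι → ι → Prop} [IsStrictOrder ι r]
    {π₁ : ∀ j, K₁ →+ G₁ j} {π₂ : ∀ j, K₂ →+ G₂ j} {π₃ : ∀ j, K₃ →+ G₃ j}
    {δ₁ : K₁ →+ K₂} {δ₂ : K₂ →+ K₃} {ε₁ : ∀ j, G₁ j →+ G₂ j} {ε₂ : ∀ j, G₂ j →+ G₃ j}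
    (h₁ : IsTriangular r π₁ π₂ δ₁ ε₁) (h₂ : IsTriangular r π₂ π₃ δ₂ ε₂)
    (hε : ∀ j, Function.Exact (ε₁ j) (ε₂ j))
    (hπ₁ : ∀ j (g : G₁ j), ∃ x, π₁ j x = g ∧ ∀ i, i ≠ j → π₁ i x = 0) {k : K₂} (hk : δ₂ k = 0)
    {n : ι} (hn : ∀ i, r i n → π₂ i k = 0) :
    ∃ c, (∀ i, i ≠ n → π₁ i c = 0) ∧ ∀ i, r i n ∨ i = n → π₂ i (k - δ₁ c) = 0 := by
  obtain ⟨g, hg⟩ := (hε n (π₂ n k)).1 (by rw [← h₂ k n hn, hk, map_zero])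
  obtain ⟨c, hcn, hc⟩ := hπ₁ n g
  have hc_lt : ∀ i, r i n → π₁ i c = 0 := fun i hi => hc i (ne_of_irrefl hi)
  refine ⟨c, hc, ?_⟩
  rintro i (hi | rfl)
  · rw [map_sub, hn i hi, h₁.map_eq_zero (fun j hj => hc_lt j (_root_.trans hj hi)) (hc_lt i hi),
      sub_zero]
  · rw [map_sub, h₁ c i hc_lt, hcn, hg, sub_self]

variable {G₁ G₂ G₃ : ℕ → Type*} [∀ j, AddCommGroup (G₁ j)] [∀ j, AddCommGroup (G₂ j)]
  [∀ j, AddCommGroup (G₃ j)] {π₁ : ∀ j, K₁ →+ G₁ j} {π₂ : ∀ j, K₂ →+ G₂ j}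
  {π₃ : ∀ j, K₃ →+ G₃ j} {δ₁ : K₁ →+ K₂} {δ₂ : K₂ →+ K₃} {ε₁ : ∀ j, G₁ j →+ G₂ j}
  {ε₂ : ∀ j, G₂ j →+ G₃ j}

lemma exact_of_isTriangular_of_isSumCoord (h₁ : IsTriangular (· > ·) π₁ π₂ δ₁ ε₁)
    (h₂ : IsTriangular (· > ·) π₂ π₃ δ₂ ε₂) (hε : ∀ j, Function.Exact (ε₁ j) (ε₂ j))
    (hπ₁ : IsSumCoord π₁) (hπ₂ : IsSumCoord π₂) (hδ : ∀ c, δ₂ (δ₁ c) = 0) :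
    Function.Exact δ₁ δ₂ := by
  refine fun k => ⟨fun hk => ?_, by rintro ⟨c, rfl⟩; exact hδ c⟩
  suffices h : ∀ n k, δ₂ k = 0 → (∀ j, n ≤ j → π₂ j k = 0) → k ∈ Set.range δ₁ by
    obtain ⟨n, hn⟩ := (hπ₂.finite k).bddAbove
    exact h (n + 1) k hk fun j hj => by_contra fun hjk => absurd (hn hjk) (by omega)
  intro n
  induction n with
  | zero => exact fun k _ hk => ⟨0, by rw [map_zero, hπ₂.ext k fun j => hk j j.zero_le]⟩
  | succ n ih =>
    intro k hk hkn
    obtain ⟨c, -, hc⟩ := h₁.exists_sub_eq_zero h₂ hε hπ₁.exists_single hk (n := n) hkn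
    obtain ⟨c', hc'⟩ := ih (k - δ₁ c) (by rw [map_sub, hδ, hk, sub_zero])
      fun j hj => hc j (hj.lt_or_eq.imp_right Eq.symm)
    exact ⟨c' + c, by rw [map_add, hc', sub_add_cancel]⟩

lemma exact_of_isTriangular_of_isProductCoord (h₁ : IsTriangular (· < ·) π₁ π₂ δ₁ ε₁)
    (h₂ : IsTriangular (· < ·) π₂ π₃ δ₂ ε₂) (hε : ∀ j, Function.Exact (ε₁ j) (ε₂ j))
    (hπ₁ : IsProductCoord π₁) (hπ₂ : IsProductCoord π₂) (hδ : ∀ c, δ₂ (δ₁ c) = 0) :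
    Function.Exact δ₁ δ₂ := by
  refine fun k => ⟨fun hk => ?_, by rintro ⟨c, rfl⟩; exact hδ c⟩
  have hstep : ∀ n c, (∀ j < n, π₂ j (k - δ₁ c) = 0) →
      ∃ c', (∀ j < n + 1, π₂ j (k - δ₁ c') = 0) ∧ ∀ j < n, π₁ j c' = π₁ j c := by
    intro n c hc
    obtain ⟨b, hb, hb'⟩ := h₁.exists_sub_eq_zero h₂ hε hπ₁.exists_single
      (k := k - δ₁ c) (by rw [map_sub, hδ, hk, sub_zero]) hc
    refine ⟨c + b, fun j hj => ?_, fun j hj => by rw [map_add, hb j hj.ne, add_zero]⟩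
    rw [map_add, ← sub_sub]
    exact hb' j (Nat.lt_succ_iff_lt_or_eq.1 hj)
  -- Since `next` does not change the lower coordinates, its iterates converge coordinatewise.
  choose! next hnext hnext_eq using hstep
  let c : ℕ → K₁ := fun n => Nat.rec 0 next n
  have hc : ∀ n, ∀ j < n, π₂ j (k - δ₁ (c n)) = 0 := by
    intro n
    induction n with
    | zero => exact fun j hj => absurd hj j.not_lt_zero
    | succ n ih => exact hnext n (c n) ih
  have hc_eq : ∀ j n, j < n → π₁ j (c n) = π₁ j (c (j + 1)) := fun j n hj => by
    induction n, hj using Nat.le_induction with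
    | base => rfl
    | succ n hn ih => exact (hnext_eq n (c n) (hc n) j hn).trans ih
  obtain ⟨l, hl⟩ := hπ₁.exists_eq fun j => π₁ j (c (j + 1))
  have hl_eq : ∀ n, ∀ j < n, π₁ j (c n - l) = 0 := fun n j hj => by
    rw [map_sub, hl, hc_eq j n hj, sub_self]
  refine ⟨l, (sub_eq_zero.1 (hπ₂.ext _ fun j => ?_)).symm⟩
  have hj : π₂ j (δ₁ (c (j + 1) - l)) = 0 :=
    h₁.map_eq_zero (fun i hi => hl_eq _ i (Nat.lt_succ_of_lt hi)) (hl_eq _ j j.lt_succ_self)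
  rw [← sub_add_sub_cancel k (δ₁ (c (j + 1))), map_add, hc _ j j.lt_succ_self, zero_add,
    ← map_sub, hj]

end TriangularExact

section Cone

/-- The differential `(x, y) ↦ (d x, f x - b y)` of the mapping cone of a chain map, between two
consecutive degrees: `d` and `b` are differentials of the source and of the target, and `f` is the
component of the chain map in the degree where `d` starts and `b` ends. -/
def coneD {A A' B B' : Type*} [AddCommGroup A] [AddCommGroup A'] [AddCommGroup B] [AddCommGroup B']
    (d : A →+ A') (f : A →+ B') (b : B →+ B') : A × B →+ A' × B' :=
  (d.comp (.fst A B)).prod (f.comp (.fst A B) - b.comp (.snd A B))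

/-- Exactness of the mapping cone of the family of maps `f p`, with respect to the families of
maps of degree `-1` contained in `dA` and `dB`. -/
def ConeExact {A B : ℤ → Type*} [∀ p, AddCommGroup (A p)] [∀ p, AddCommGroup (B p)]
    (dA : ∀ p q, A p →+ A q) (dB : ∀ p q, B p →+ B q) (f : ∀ p, A p →+ B p) : Prop :=
  ∀ ⦃p q r s : ℤ⦄, q + 1 = p → p + 1 = r → s + 1 = q →
    Function.Exact (coneD (dA p q) (f p) (dB r p)) (coneD (dA q s) (f q) (dB p q))

lemma IsTriangular.coneD {ι : Type*} {A A' B B' : Type*} [AddCommGroup A] [AddCommGroup A']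
    [AddCommGroup B] [AddCommGroup B'] {G G' H H' : ι → Type*} [∀ j, AddCommGroup (G j)]
    [∀ j, AddCommGroup (G' j)] [∀ j, AddCommGroup (H j)] [∀ j, AddCommGroup (H' j)]
    {r : ι → ι → Prop} {α : ∀ j, A →+ G j} {α' : ∀ j, A' →+ G' j} {β : ∀ j, B →+ H j}
    {β' : ∀ j, B' →+ H' j} {d : A →+ A'} {f : A →+ B'} {b : B →+ B'} {d' : ∀ j, G j →+ G' j}
    {f' : ∀ j, G j →+ H' j} {b' : ∀ j, H j →+ H' j} (hd : IsTriangular r α α' d d')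
    (hf : IsTriangular r α β' f f') (hb : IsTriangular r β β' b b') :
    IsTriangular r (fun j => (α j).prodMap (β j)) (fun j => (α' j).prodMap (β' j))
      (coneD d f b) fun j => coneD (d' j) (f' j) (b' j) := by
  rintro ⟨x, y⟩ j hxy
  have hx : ∀ i, r i j → α i x = 0 := fun i hi => congrArg Prod.fst (hxy i hi)
  have hy : ∀ i, r i j → β i y = 0 := fun i hi => congrArg Prod.snd (hxy i hi)
  refine Prod.ext (hd x j hx) ?_
  change β' j (f x - b y) = f' j (α j x) - b' j (β j y)
  rw [map_sub, hf x j hx, hb y j hy]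

lemma coneD_coneD {A A' A'' B B' B'' : Type*} [AddCommGroup A] [AddCommGroup A'] [AddCommGroup A'']
    [AddCommGroup B] [AddCommGroup B'] [AddCommGroup B''] {d : A →+ A'} {d' : A' →+ A''}
    {f : A →+ B'} {f' : A' →+ B''} {b : B →+ B'} {b' : B' →+ B''} (hd : ∀ x, d' (d x) = 0)
    (hb : ∀ y, b' (b y) = 0) (hf : ∀ x, f' (d x) = b' (f x)) (x : A × B) :
    coneD d' f' b' (coneD d f b x) = 0 := by
  refine Prod.ext (hd x.1) ?_
  change f' (d x.1) - b' (f x.1 - b x.2) = 0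
  rw [hf, map_sub, hb, sub_zero, sub_self]

variable {A B : ℤ → Type*} [∀ p, AddCommGroup (A p)] [∀ p, AddCommGroup (B p)]
  {dA : ∀ p q, A p →+ A q} {dB : ∀ p q, B p →+ B q} {f : ∀ p, A p →+ B p}

lemma ConeExact.of_addEquiv {A' B' : ℤ → Type*} [∀ p, AddCommGroup (A' p)]
    [∀ p, AddCommGroup (B' p)] {dA' : ∀ p q, A' p →+ A' q} {dB' : ∀ p q, B' p →+ B' q}
    {f' : ∀ p, A' p →+ B' p} (α : ∀ p, A p ≃+ A' p) (β : ∀ p, B p ≃+ B' p)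
    (hα : ∀ p q, q + 1 = p → ∀ x, α q (dA p q x) = dA' p q (α p x))
    (hβ : ∀ p q, q + 1 = p → ∀ y, β q (dB p q y) = dB' p q (β p y))
    (hf : ∀ p x, β p (f p x) = f' p (α p x)) (h : ConeExact dA' dB' f') : ConeExact dA dB f := by
  have h_comm {p q r : ℤ} (hq : q + 1 = p) (hr : p + 1 = r) :
      (coneD (dA' p q) (f' p) (dB' r p)).comp ((α p).prodCongr (β r)).toAddMonoidHom =
        ((α q).prodCongr (β p)).toAddMonoidHom.comp (coneD (dA p q) (f p) (dB r p)) := by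
    refine AddMonoidHom.ext fun x => Prod.ext (hα p q hq x.1).symm ?_
    change f' p (α p x.1) - dB' r p (β r x.2) = β p (f p x.1 - dB r p x.2)
    rw [map_sub, hf, hβ r p hr]
  exact fun p q r s hq hr hs => (Function.Exact.iff_of_ladder_addEquiv
    ((α p).prodCongr (β r)) ((α q).prodCongr (β p)) ((α s).prodCongr (β q)) (h_comm hq hr)
    (h_comm hs hq)).1 (h hq hr hs)

variable {G H : ℕ → ℤ → Type*} [∀ j p, AddCommGroup (G j p)] [∀ j p, AddCommGroup (H j p)]
  {α : ∀ p j, A p →+ G j p} {β : ∀ p j, B p →+ H j p} {dG : ∀ j p q, G j p →+ G j q}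
  {dH : ∀ j p q, H j p →+ H j q} {g : ∀ j p, G j p →+ H j p}

lemma coneExact_of_isSumCoord (hα : ∀ p, IsSumCoord (α p)) (hβ : ∀ p, IsSumCoord (β p))
    (htA : ∀ p q, q + 1 = p → IsTriangular (· > ·) (α p) (α q) (dA p q) (dG · p q))
    (htB : ∀ p q, q + 1 = p → IsTriangular (· > ·) (β p) (β q) (dB p q) (dH · p q))
    (htf : ∀ p, IsTriangular (· > ·) (α p) (β p) (f p) (g · p))
    (hdA : ∀ p q s x, dA q s (dA p q x) = 0) (hdB : ∀ p q s y, dB q s (dB p q y) = 0)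
    (hf : ∀ p q, q + 1 = p → ∀ x, f q (dA p q x) = dB p q (f p x))
    (h : ∀ j, ConeExact (dG j) (dH j) (g j)) : ConeExact dA dB f := fun p q r s hq hr hs =>
  exact_of_isTriangular_of_isSumCoord ((htA p q hq).coneD (htf p) (htB r p hr))
    ((htA q s hs).coneD (htf q) (htB p q hq)) (fun j => h j hq hr hs)
    ((hα p).prodMap (hβ r)) ((hα q).prodMap (hβ p))
    (coneD_coneD (hdA p q s) (hdB r p q) (hf p q hq))

lemma coneExact_of_isProductCoord (hα : ∀ p, IsProductCoord (α p)) (hβ : ∀ p, IsProductCoord (β p))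
    (htA : ∀ p q, q + 1 = p → IsTriangular (· < ·) (α p) (α q) (dA p q) (dG · p q))
    (htB : ∀ p q, q + 1 = p → IsTriangular (· < ·) (β p) (β q) (dB p q) (dH · p q))
    (htf : ∀ p, IsTriangular (· < ·) (α p) (β p) (f p) (g · p))
    (hdA : ∀ p q s x, dA q s (dA p q x) = 0) (hdB : ∀ p q s y, dB q s (dB p q y) = 0)
    (hf : ∀ p q, q + 1 = p → ∀ x, f q (dA p q x) = dB p q (f p x))
    (h : ∀ j, ConeExact (dG j) (dH j) (g j)) : ConeExact dA dB f := fun p q r s hq hr hs =>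
  exact_of_isTriangular_of_isProductCoord ((htA p q hq).coneD (htf p) (htB r p hr))
    ((htA q s hs).coneD (htf q) (htB p q hq)) (fun j => h j hq hr hs)
    ((hα p).prodMap (hβ r)) ((hα q).prodMap (hβ p))
    (coneD_coneD (hdA p q s) (hdB r p q) (hf p q hq))

end Cone

section QuasiIso

lemma abLeftHomologyData_π_eq_zero_iff (S : ShortComplex Ab.{u}) (k : S.abLeftHomologyData.K) :
    S.abLeftHomologyData.π k = 0 ↔ ∃ z, S.f z = S.abLeftHomologyData.i k :=
  (QuotientAddGroup.eq_zero_iff (G := AddMonoidHom.ker S.g.hom)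
    (N := AddMonoidHom.range S.abToCycles) k).trans (exists_congr fun _ => Subtype.ext_iff)

variable {S T : ShortComplex Ab.{u}} {φ : S ⟶ T}
  (γ : ShortComplex.LeftHomologyMapData φ S.abLeftHomologyData T.abLeftHomologyData)

include γ in
lemma i_φK_apply (k : S.abLeftHomologyData.K) :
    T.abLeftHomologyData.i (γ.φK k) = φ.τ₂ (S.abLeftHomologyData.i k) :=
  ConcreteCategory.congr_hom γ.commi k

include γ in
lemma φH_π_apply (k : S.abLeftHomologyData.K) :
    γ.φH (S.abLeftHomologyData.π k) = T.abLeftHomologyData.π (γ.φK k) :=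
  ConcreteCategory.congr_hom γ.commπ k

lemma injective_φH_iff : Function.Injective γ.φH ↔
    ∀ (x : S.X₂) (y : T.X₁), S.g x = 0 → φ.τ₂ x = T.f y → ∃ z, S.f z = x := by
  refine (injective_iff_map_eq_zero γ.φH.hom).trans ⟨fun h x y hx hy => ?_, fun h c hc => ?_⟩
  · refine (abLeftHomologyData_π_eq_zero_iff S ⟨x, hx⟩).1 (h _ ?_)
    exact (φH_π_apply γ _).trans ((abLeftHomologyData_π_eq_zero_iff T _).2
      ⟨y, hy.symm.trans (i_φK_apply γ ⟨x, hx⟩).symm⟩)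
  · obtain ⟨k, rfl⟩ := QuotientAddGroup.mk_surjective c
    obtain ⟨y, hy⟩ := (abLeftHomologyData_π_eq_zero_iff T _).1 ((φH_π_apply γ k).symm.trans hc)
    exact (abLeftHomologyData_π_eq_zero_iff S k).2
      (h k.1 y k.2 ((i_φK_apply γ k).symm.trans hy.symm))

lemma surjective_φH_iff : Function.Surjective γ.φH ↔
    ∀ y : T.X₂, T.g y = 0 → ∃ (x : S.X₂) (z : T.X₁), S.g x = 0 ∧ φ.τ₂ x + T.f z = y := by
  have hφ (x : S.abLeftHomologyData.K) (y : T.abLeftHomologyData.K) :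
      γ.φH (S.abLeftHomologyData.π x) = T.abLeftHomologyData.π y ↔
        ∃ z, φ.τ₂ x.1 + T.f z = y.1 := by
    rw [φH_π_apply, eq_comm, ← sub_eq_zero, ← map_sub, abLeftHomologyData_π_eq_zero_iff, map_sub,
      i_φK_apply]
    exact exists_congr fun z => eq_sub_iff_add_eq'
  refine ⟨fun h y hy => ?_, fun h c => ?_⟩
  · obtain ⟨c, hc⟩ := h (T.abLeftHomologyData.π ⟨y, hy⟩)
    obtain ⟨x, rfl⟩ := QuotientAddGroup.mk_surjective c
    obtain ⟨z, hz⟩ := (hφ x ⟨y, hy⟩).1 hc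
    exact ⟨x.1, z, x.2, hz⟩
  · obtain ⟨y, rfl⟩ := QuotientAddGroup.mk_surjective c
    obtain ⟨x, z, hx, hz⟩ := h y.1 y.2
    exact ⟨S.abLeftHomologyData.π ⟨x, hx⟩, (hφ ⟨x, hx⟩ y).2 ⟨z, hz⟩⟩

lemma quasiIsoAt_iff_injective_surjective {K L : ChainComplex AddCommGrpCat.{u} ℤ} (f : K ⟶ L)
    {p q r : ℤ} (hq : q + 1 = p) (hr : p + 1 = r) : QuasiIsoAt f p ↔
      (∀ (x : K.X p) (y : L.X r), K.d p q x = 0 → f.f p x = L.d r p y → ∃ z, K.d r p z = x) ∧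
        ∀ y : L.X p, L.d p q y = 0 →
          ∃ (x : K.X p) (z : L.X r), K.d p q x = 0 ∧ f.f p x + L.d r p z = y := by
  rw [quasiIsoAt_iff' f r p q ((ComplexShape.down ℤ).prev_eq' hr)
    ((ComplexShape.down ℤ).next_eq' hq)]
  let γ := ShortComplex.leftHomologyMapData
    ((HomologicalComplex.shortComplexFunctor' _ _ r p q).map f)
    (ShortComplex.abLeftHomologyData _) (ShortComplex.abLeftHomologyData _)
  rw [γ.quasiIso_iff, ConcreteCategory.isIso_iff_bijective]
  exact and_congr (injective_φH_iff γ) (surjective_φH_iff γ)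

lemma quasiIso_iff_coneExact {K L : ChainComplex AddCommGrpCat.{u} ℤ} (f : K ⟶ L) :
    QuasiIso f ↔ ConeExact (A := fun p => K.X p) (B := fun p => L.X p)
      (fun p q => (K.d p q).hom) (fun p q => (L.d p q).hom) (fun p => (f.f p).hom) := by
  have hf (p q) (x : K.X p) : f.f q (K.d p q x) = L.d p q (f.f p x) :=
    (ConcreteCategory.congr_hom (f.comm p q) x).symm
  have hK (p q s) (x : K.X p) : K.d q s (K.d p q x) = 0 :=
    ConcreteCategory.congr_hom (K.d_comp_d p q s) x
  have hL (p q s) (x : L.X p) : L.d q s (L.d p q x) = 0 :=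
    ConcreteCategory.congr_hom (L.d_comp_d p q s) x
  rw [quasiIso_iff]
  refine ⟨fun h p q r s hq hr hs z => ⟨fun hz => ?_, ?_⟩, fun h p => ?_⟩
  · obtain ⟨x, y⟩ := z
    obtain ⟨hx, hy⟩ := Prod.ext_iff.1 hz
    replace hy : f.f q x = L.d p q y := sub_eq_zero.1 hy
    obtain ⟨u, rfl⟩ := ((quasiIsoAt_iff_injective_surjective f hs hq).1 (h q)).1 x y hx hy
    obtain ⟨u', v, hu', hv⟩ := ((quasiIsoAt_iff_injective_surjective f hq hr).1 (h p)).2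
      (y - f.f p u) (by rw [map_sub, ← hf, hy, sub_self])
    refine ⟨(u + u', -v), Prod.ext ?_ ?_⟩
    · change K.d p q (u + u') = K.d p q u
      rw [map_add, hu', add_zero]
    · change f.f p (u + u') - L.d r p (-v) = y
      rw [map_neg, sub_neg_eq_add, map_add, add_assoc, hv, add_sub_cancel]
  · rintro ⟨z, rfl⟩
    exact coneD_coneD (hK p q s) (hL r p q) (hf p q) z
  · refine (quasiIsoAt_iff_injective_surjective f (sub_add_cancel p 1) rfl).2
      ⟨fun x y hx hy => ?_, fun y hy => ?_⟩
    · obtain ⟨z, hz⟩ := (h (p := p + 1) rfl rfl (sub_add_cancel p 1) (x, y)).1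
        (Prod.ext hx (sub_eq_zero.2 hy))
      exact ⟨z.1, congrArg Prod.fst hz⟩
    · obtain ⟨z, hz⟩ := (h (sub_add_cancel p 1) rfl (sub_add_cancel (p - 1) 1) (0, y)).1
        (Prod.ext (map_zero (K.d (p - 1) (p - 1 - 1)).hom) (by simpa [coneD] using hy))
      refine ⟨z.1, -z.2, congrArg Prod.fst hz, ?_⟩
      rw [map_neg, ← sub_eq_add_neg]
      exact congrArg Prod.snd hz

end QuasiIso

section DirectSum

variable {ι : Type*} {G : ι → Type*} [∀ j, AddCommGroup (G j)]

lemma isSumCoord_evalAddMonoidHom :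
    IsSumCoord (K := Π₀ j, G j) fun j => DFinsupp.evalAddMonoidHom j where
  ext _ hx := DFinsupp.ext hx
  finite x := x.finite_support
  exists_single j g := by
    classical
    exact ⟨DFinsupp.single j g, DFinsupp.single_eq_same (b := g),
      fun i hi => DFinsupp.single_eq_of_ne (b := g) hi⟩

lemma isTriangular_of_single [DecidableEq ι] {r : ι → ι → Prop} {G' : ι → Type*}
    [∀ j, AddCommGroup (G' j)] {K' : Type*} [AddCommGroup K'] {π' : ∀ j, K' →+ G' j}
    {δ : (Π₀ j, G j) →+ K'} {ε : ∀ j, G j →+ G' j}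
    (h_diag : ∀ j g, π' j (δ (DFinsupp.single j g)) = ε j g)
    (h_off : ∀ i j g, i ≠ j → ¬ r i j → π' j (δ (DFinsupp.single i g)) = 0) :
    IsTriangular r (fun j => DFinsupp.evalAddMonoidHom j) π' δ ε := by
  classical
  intro x j hx
  conv_lhs => rw [← DFinsupp.sum_single (f := x)]
  rw [DFinsupp.sum, map_sum, map_sum, ← h_diag j]
  refine Finset.sum_eq_single j (fun i _ hij => ?_) fun hj => ?_
  · by_cases hr : r i j
    · rw [show x i = 0 from hx i hr, DFinsupp.single_zero, map_zero, map_zero]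
    · exact h_off i j (x i) hij hr
  · rw [DFinsupp.notMem_support_iff.1 hj, DFinsupp.single_zero, map_zero, map_zero]

end DirectSum

section Hoch

variable {X Y Z : ℕ → ℤ → AddCommGrpCat.{u}}

/-- The coordinate `∑ x_n ⊗ l_n ↦ x_{j+1}` of an element of degree `p` of the Hochschild complex. -/
def hochCoord (X : ℕ → ℤ → AddCommGrpCat.{u}) (m : ℕ) (p : ℤ) (j : ℕ) :
    hochX X m p →+ X (j + 1 + m) (p - j) :=
  DFinsupp.evalAddMonoidHom (β := fun j : ℕ => X (j + 1 + m) (p - j)) j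

lemma isSumCoord_hochCoord (m : ℕ) (p : ℤ) : IsSumCoord (hochCoord X m p) :=
  isSumCoord_evalAddMonoidHom (G := fun j : ℕ => X (j + 1 + m) (p - j))

lemma single_eq_hochInc {m : ℕ} {p : ℤ} (j : ℕ) (x : X (j + 1 + m) (p - j)) :
    (DFinsupp.single j x : Π₀ j : ℕ, X (j + 1 + m) (p - j)) =
      hochInc j (sub_add_cancel p j) x := by
  simp only [hochInc, eqToHom_refl]
  rfl

lemma hochCoord_hochInc_self {m : ℕ} {p : ℤ} (j : ℕ) (x : X (j + 1 + m) (p - j)) :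
    hochCoord X m p j (hochInc j (sub_add_cancel p j) x) = x := by
  rw [← single_eq_hochInc]
  exact DFinsupp.single_eq_same

lemma hochCoord_hochInc_of_ne {m : ℕ} {p' p : ℤ} {i j : ℕ} (hij : i ≠ j) (h : p' + i = p)
    (x : X (i + 1 + m) p') : hochCoord X m p j (hochInc i h x) = 0 := by
  obtain rfl : p' = p - i := by omega
  rw [← single_eq_hochInc]
  exact DFinsupp.single_eq_of_ne hij.symm

lemma isTriangular_of_hochInc {m : ℕ} {p q : ℤ} {δ : hochX X m p →+ hochX Y m q}
    {ε : ∀ j : ℕ, X (j + 1 + m) (p - j) →+ Y (j + 1 + m) (q - j)}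
    (h_diag : ∀ j x, hochCoord Y m q j (δ (hochInc j (sub_add_cancel p j) x)) = ε j x)
    (h_off : ∀ i j x, i < j → hochCoord Y m q j (δ (hochInc i (sub_add_cancel p i) x)) = 0) :
    IsTriangular (· > ·) (hochCoord X m p) (hochCoord Y m q) δ ε := by
  have h_single (i j : ℕ) (x : X (i + 1 + m) (p - i)) :=
    congrArg (fun z => hochCoord Y m q j (δ z)) (single_eq_hochInc i x)
  exact isTriangular_of_single (fun j x => (h_single j j x).trans (h_diag j x))
    fun i j x hne hij => (h_single i j x).trans (h_off i j x (lt_of_le_of_ne (not_lt.1 hij) hne))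

lemma isTriangular_hochMap (θ : GrHom X Y 0) (m : ℕ) (p : ℤ) :
    IsTriangular (· > ·) (hochCoord X m p) (hochCoord Y m p) (hochMap θ m p p (add_zero p))
      fun j => θ (j + 1 + m) (p - j) (p - j) (add_zero _) := by
  have h (j : ℕ) (x : X (j + 1 + m) (p - j)) :
      hochMap θ m p p (add_zero p) (hochInc j (sub_add_cancel p j) x) =
        hochInc j (sub_add_cancel p j) (θ _ _ _ (add_zero _) x) := by
    rw [hochMap_inc θ _ j _ (sub_add_cancel p j) (add_zero _), mul_zero, sgn_zero, one_smul]
  refine isTriangular_of_hochInc (fun j x => ?_) fun i j x hij => ?_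
  · rw [h, hochCoord_hochInc_self]
  · rw [h, hochCoord_hochInc_of_ne hij.ne]

lemma hochMap_add {s : ℤ} (θ η : GrHom X Y s) : hochMap (θ + η) = hochMap θ + hochMap η := by
  funext m p q h
  refine hoch_hom_ext fun j p' hp x => ?_
  rw [hochMap_inc _ h j hp (q' := p' + s) (by omega) rfl]
  change _ = hochMap θ m p q h _ + hochMap η m p q h _
  rw [hochMap_inc _ h j hp (q' := p' + s) (by omega) rfl,
    hochMap_inc _ h j hp (q' := p' + s) (by omega) rfl, GrHom.add_apply, map_add, smul_add]

lemma hochMap_id : hochMap (GrHom.id X) = GrHom.id (hochX X) := by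
  funext m p q h
  obtain rfl : p = q := by omega
  refine hoch_hom_ext fun j p' hp x => ?_
  rw [hochMap_inc _ h j hp hp (add_zero _), GrHom.id_apply, GrHom.id_apply, mul_zero, sgn_zero,
    one_smul]

lemma hochMap_comp {s t r : ℤ} (h : s + t = r) (θ : GrHom X Y s) (η : GrHom Y Z t) :
    hochMap (GrHom.comp h θ η) = GrHom.comp h (hochMap θ) (hochMap η) := by
  funext m p q hq
  refine hoch_hom_ext fun j p' hp x => ?_
  have hs : sgn (j * r) = sgn (j * s + j * t) := by rw [← h, mul_add]
  rw [hochMap_inc _ hq j hp (q' := p' + r) (by omega) rfl,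
    GrHom.comp_apply h _ _ _ (p' := p + s) rfl (by omega),
    hochMap_inc _ _ j hp (q' := p' + s) (by omega) rfl, map_zsmul,
    hochMap_inc _ _ j _ (q' := p' + r) (by omega) (by omega), smul_smul, ← sgn_add,
    GrHom.comp_apply h _ _ _ (p' := p' + s) rfl (by omega), hs]

lemma hochIterMap_add {s : ℤ} (θ η : GrHom X Y s) :
    ∀ n, hochIterMap (θ + η) n = hochIterMap θ n + hochIterMap η n
  | 0 => rfl
  | n + 1 => (congrArg hochMap (hochIterMap_add θ η n)).trans (hochMap_add _ _)

lemma hochIterMap_id : ∀ n, hochIterMap (GrHom.id X) n = GrHom.id (hochIterX n X)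
  | 0 => rfl
  | n + 1 => (congrArg hochMap (hochIterMap_id n)).trans hochMap_id

lemma hochIterMap_comp {s t r : ℤ} (h : s + t = r) (θ : GrHom X Y s) (η : GrHom Y Z t) :
    ∀ n, hochIterMap (GrHom.comp h θ η) n = GrHom.comp h (hochIterMap θ n) (hochIterMap η n)
  | 0 => rfl
  | n + 1 => (congrArg hochMap (hochIterMap_comp h θ η n)).trans (hochMap_comp h _ _)

lemma hochIterMap_zero {s : ℤ} (n : ℕ) : hochIterMap (0 : GrHom X Y s) n = 0 :=
  left_eq_add.1 ((congrArg (hochIterMap · n) (add_zero 0).symm).trans (hochIterMap_add 0 0 n))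

namespace AinfProp

variable {E : AinfProp.{u}}

lemma isTriangular_hochD (S : DGModule E.toDGCat X) (m : ℕ) {p q : ℤ} (hq : q + 1 = p) :
    IsTriangular (· > ·) (hochCoord X m p) (hochCoord X m q) (hochD S m p q)
      fun j => S.d (j + 1 + m) (p - j) (q - j) := by
  have h_low (j j' : ℕ) (hj : j ≤ j') (x : X (j + 1 + m) (p - j)) :
      hochCoord X m q j' (hochD S m p q (hochInc j (sub_add_cancel p j) x)) =
        hochCoord X m q j' (hochInc j (sub_add_cancel q j) (S.d _ (p - j) (q - j) x)) := by
    rw [hochD_inc S hq _ (sub_add_cancel q j), map_add, map_zsmul, map_sum, Finset.sum_eq_zero,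
      smul_zero, add_zero]
    intro i hi
    rw [hochCoord_hochInc_of_ne ((Finset.mem_range.1 hi).trans_le hj).ne]
  refine isTriangular_of_hochInc (fun j x => ?_) fun i j x hij => ?_
  · rw [h_low j j le_rfl, hochCoord_hochInc_self]
  · rw [h_low i j hij.le, hochCoord_hochInc_of_ne hij.ne]

lemma coneExact_hochMap (S : DGModule E.toDGCat X) (T : DGModule E.toDGCat Y) (θ : GrHom X Y 0)
    (hθ : ∀ m p q, q + 1 = p → ∀ x, hochMap θ m q q (add_zero q) (hochD S m p q x) =
      hochD T m p q (hochMap θ m p p (add_zero p) x))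
    (hc : ∀ a, ConeExact (S.d a) (T.d a) fun p => θ a p p (add_zero p)) (m : ℕ) :
    ConeExact (hochD S m) (hochD T m) fun p => hochMap θ m p p (add_zero p) :=
  coneExact_of_isSumCoord (isSumCoord_hochCoord m) (isSumCoord_hochCoord m)
    (fun _ _ => isTriangular_hochD S m) (fun _ _ => isTriangular_hochD T m)
    (isTriangular_hochMap θ m) ((hochStr S).d_d m) ((hochStr T).d_d m) (hθ m)
    fun j _ _ _ _ hq hr hs => hc (j + 1 + m) (by omega) (by omega) (by omega)

lemma hochIterMap_d (S : DGModule E.toDGCat X) (T : DGModule E.toDGCat Y)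
    {θ : GrHom X Y 0} (hθ : GrHom.IsNat S T θ)
    (hd : GrHom.diff S.d T.d (neg_add_cancel 1) θ = 0) (n m : ℕ) (p q : ℤ) (hq : q + 1 = p)
    (x : hochIterX n X m p) :
    hochIterMap θ n m q q (add_zero q) ((hochIterStr S n).d m p q x) =
      (hochIterStr T n).d m p q (hochIterMap θ n m p p (add_zero p) x) := by
  have h := GrHom.d_apply (hochIterStr S n).d (hochIterStr T n).d (neg_add_cancel 1)
    (hochIterMap θ n) m (p := p) (q := q) (by omega) hq hq x
  rw [diff_hochIterMap S T _ θ hθ, hd, hochIterMap_zero, GrHom.zero_apply, smul_zero] at h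
  exact (h.trans (add_zero _)).symm

lemma coneExact_hochIterMap (S : DGModule E.toDGCat X) (T : DGModule E.toDGCat Y)
    {θ : GrHom X Y 0} (hθ : GrHom.IsNat S T θ)
    (hd : GrHom.diff S.d T.d (neg_add_cancel 1) θ = 0)
    (hc : ∀ a, ConeExact (S.d a) (T.d a) fun p => θ a p p (add_zero p)) :
    ∀ n m : ℕ, ConeExact ((hochIterStr S n).d m) ((hochIterStr T n).d m)
      fun p => hochIterMap θ n m p p (add_zero p)
  | 0 => hc
  | n + 1 => coneExact_hochMap (hochIterStr S n) (hochIterStr T n) (hochIterMap θ n)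
      (hochIterMap_d S T hθ hd (n + 1)) (coneExact_hochIterMap S T hθ hd hc n)

end AinfProp

end Hoch

section Representable

variable {O : Type w}

/-- The representable dg-functor `A(a, -)`. -/
abbrev DGCat.rep (A : DGCat.{u} O) (a : O) : DGFunctor A where
  X b p := (A.hom a b).X p
  str :=
    { d := fun b p q => ((A.hom a b).d p q).hom
      shape := fun b p q h => by rw [(A.hom a b).shape p q h]; rfl
      d_d := fun b p q r x => ConcreteCategory.congr_hom ((A.hom a b).d_comp_d p q r) x
      act := fun h => A.comp h
      act_id := A.comp_id
      act_comp := A.assoc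
      d_act := A.d_comp }

variable {A : DGCat.{u} O}

/-- The natural transformation `A(a, -) ⟶ Φ` corresponding to an element of `Φ(a)`. -/
def DGTrans.ofElement (Φ : DGFunctor A) {a : O} {s : ℤ} (y : Φ.X a s) :
    DGTrans (A.rep a) Φ s where
  app _ p _ h := sgn (p * s) • Φ.str.act ((add_comm s p).trans h) y
  naturality b c p q r p' r' h hp hr x f := by
    simp only [AddMonoidHom.zsmul_apply, map_zsmul]
    rw [Φ.str.act_comp ((add_comm s p).trans hp) _ h, smul_smul, ← sgn_add]
    · congr 2
      rw [← h]; ring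
    · omega

lemma DGTrans.ofElement_app (Φ : DGFunctor A) {a b : O} {s p q : ℤ} (y : Φ.X a s) (h : p + s = q)
    (h' : s + p = q) (f : (A.hom a b).X p) :
    (DGTrans.ofElement Φ y).app b p q h f = sgn (p * s) • Φ.str.act h' y f := rfl

lemma DGTrans.ofElement_app_id (Φ : DGFunctor A) {a : O} {s : ℤ} (y : Φ.X a s) :
    (DGTrans.ofElement Φ y).app a 0 s (zero_add s) (A.id a) = y := by
  rw [DGTrans.ofElement_app _ _ _ (add_zero s), Φ.str.act_id, zero_mul, sgn_zero, one_smul]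

lemma DGTrans.ofElement_app_add (Φ : DGFunctor A) {a : O} {s : ℤ} (y z : Φ.X a s) :
    (DGTrans.ofElement Φ (y + z)).app =
      (DGTrans.ofElement Φ y).app + (DGTrans.ofElement Φ z).app := by
  refine GrHom.ext fun b p q h f => ?_
  rw [GrHom.add_apply, DGTrans.ofElement_app _ _ _ (by omega),
    DGTrans.ofElement_app _ _ _ (by omega), DGTrans.ofElement_app _ _ _ (by omega), map_add,
    AddMonoidHom.add_apply, smul_add]

lemma DGTrans.ofElement_app_zero (Φ : DGFunctor A) {a : O} {s : ℤ} :
    (DGTrans.ofElement Φ (0 : Φ.X a s)).app = 0 :=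
  left_eq_add.1 ((congrArg (fun y => (DGTrans.ofElement Φ y).app) (add_zero 0).symm).trans
    (DGTrans.ofElement_app_add Φ 0 0))

lemma DGTrans.ofElement_id (a : O) :
    (DGTrans.ofElement (A.rep a) (A.id a)).app = GrHom.id (A.rep a).X := by
  refine GrHom.ext fun b p q h f => ?_
  obtain rfl : p = q := by omega
  rw [DGTrans.ofElement_app _ _ _ (zero_add p), mul_zero, sgn_zero, one_smul, GrHom.id_apply]
  exact A.id_comp f

lemma DGTrans.diff_ofElement (Φ : DGFunctor A) {a : O} {s t : ℤ} (h : t + 1 = s) (y : Φ.X a s) :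
    GrHom.diff (A.rep a).str.d Φ.str.d h (DGTrans.ofElement Φ y).app =
      (DGTrans.ofElement Φ (Φ.str.d a s t y)).app := by
  refine GrHom.ext fun b p q hq f => ?_
  rw [GrHom.diff_apply _ _ h _ b hq (p' := p - 1) (q' := q + 1) (by omega) rfl,
    DGTrans.ofElement_app _ _ _ (by omega), DGTrans.ofElement_app _ _ _ (by omega),
    DGTrans.ofElement_app _ _ _ (by omega), map_zsmul,
    Φ.str.d_act _ h (q' := p - 1) (by omega) rfl]
  simp only [smul_add, smul_sub, smul_smul, ← sgn_add]
  have h_act : sgn (p + p * s) = sgn (p * t) := sgn_congr ⟨p, by rw [← h]; ring⟩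
  have h_d : sgn (p + (p - 1) * s) = sgn (p + (p * s + s)) := sgn_congr ⟨-s, by ring⟩
  rw [h_act, h_d]
  exact add_sub_cancel_right _ _

lemma DGTrans.ofElement_comp {Φ Ψ : DGFunctor A} {a : O} {q s q' : ℤ} (hq : q + s = q')
    (θ : DGTrans Φ Ψ s) (y : Φ.X a q) :
    (DGTrans.ofElement Ψ (θ.app a q q' hq y)).app =
      GrHom.comp hq (DGTrans.ofElement Φ y).app θ.app := by
  refine GrHom.ext fun b p r h f => ?_
  rw [GrHom.comp_apply _ _ _ b (p' := p + q) rfl (by omega),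
    DGTrans.ofElement_app _ _ _ (by omega), DGTrans.ofElement_app _ _ _ (by omega), map_zsmul,
    θ.naturality _ hq (by omega), smul_smul, ← sgn_add]
  congr 2
  rw [← hq]; ring

/-- The natural transformation `A(a, -) ⟶ F^* B(a, -)` given by a dg-functor `F`. -/
def DGCat.Functor.repTrans {B : DGCat.{u} O} (F : A.Functor B) (a : O) :
    DGTrans (A.rep a) ((B.rep a).pullback F) 0 :=
  DGTrans.ofElement ((B.rep a).pullback F) (B.id a)

lemma DGCat.Functor.repTrans_app {B : DGCat.{u} O} (F : A.Functor B) (a b : O) {p : ℤ}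
    (f : (A.hom a b).X p) :
    (F.repTrans a).app b p p (add_zero p) f = (F.map a b).f p f := by
  refine (DGTrans.ofElement_app _ _ _ (zero_add p) f).trans ?_
  rw [mul_zero, sgn_zero, one_smul]
  exact B.id_comp ((F.map a b).f p f)

end Representable

namespace AinfProp

section Yoneda

variable {E : AinfProp.{u}} {a n m : ℕ}

lemma opMap_ofElement_add (Φ : DGFunctor E.toDGCat) {s p q : ℤ} (h : p + s = q) (y z : Φ.X a s)
    (x : E.opX n m (E.rep a) p) :
    E.opMap n m (DGTrans.ofElement Φ (y + z)) h x =
      E.opMap n m (DGTrans.ofElement Φ y) h x + E.opMap n m (DGTrans.ofElement Φ z) h x :=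
  congrArg (fun θ => θ m p q h x) ((congrArg (fun θ => hochIterMap θ n)
    (DGTrans.ofElement_app_add Φ y z)).trans (hochIterMap_add _ _ n))

lemma opMap_ofElement_id (p : ℤ) (x : E.opX n m (E.rep a) p) :
    E.opMap n m (DGTrans.ofElement (E.rep a) (E.id a)) (add_zero p) x = x :=
  (congrArg (fun θ => θ m p p (add_zero p) x) ((congrArg (fun θ => hochIterMap θ n)
    (DGTrans.ofElement_id a)).trans (hochIterMap_id n))).trans (GrHom.id_apply _ _ _)

lemma opMap_ofElement_app {Φ Ψ : DGFunctor E.toDGCat} {q s q' p r r' : ℤ} (hq : q + s = q')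
    (θ : DGTrans Φ Ψ s) (y : Φ.X a q) (hr : p + q' = r') (hr' : p + q = r) (hr'' : r + s = r')
    (x : E.opX n m (E.rep a) p) :
    E.opMap n m (DGTrans.ofElement Ψ (θ.app a q q' hq y)) hr x =
      E.opMap n m θ hr'' (E.opMap n m (DGTrans.ofElement Φ y) hr' x) :=
  (congrArg (fun η => η m p r' hr x) ((congrArg (fun η => hochIterMap η n)
    (DGTrans.ofElement_comp hq θ y)).trans (hochIterMap_comp hq _ _ n))).trans
    (GrHom.comp_apply hq _ _ m hr' hr'' hr x)

/-- The value of a natural transformation `Φ(a) ⟶ C^n(Φ)(m)` at the identity of `a`. -/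
def opEval (a n m : ℕ) (p : ℤ) : E.opHom 0 a n m p →+ E.opX n m (E.rep a) p where
  toFun ν := ν.1 (E.rep a) 0 p (zero_add p) (E.id a)
  map_zero' := rfl
  map_add' _ _ := rfl

lemma opHom_apply_eq {p : ℤ} (ν : E.opHom 0 a n m p) (Φ : DGFunctor E.toDGCat) {q r : ℤ}
    (h : q + p = r) (h' : p + q = r) (y : Φ.X a q) :
    ν.1 Φ q r h y = sgn (q * p) • E.opMap n m (DGTrans.ofElement Φ y) h' (opEval a n m p ν) :=
  (congrArg (ν.1 Φ q r h) (DGTrans.ofElement_app_id Φ y).symm).trans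
    (ν.2 (DGTrans.ofElement Φ y) (zero_add p) (zero_add q) h (E.id a))

/-- The natural transformation `Φ(a) ⟶ C^n(Φ)(m)` corresponding to an element of
`C^n(E(a, -))(m)`. -/
def opOfElement {p : ℤ} (x : E.opX n m (E.rep a) p) : E.opHom 0 a n m p where
  val Φ q r h := AddMonoidHom.mk' (fun y : Φ.X a q => sgn (q * p) •
    E.opMap n m (DGTrans.ofElement Φ y) ((add_comm p q).trans h) x) fun y z =>
      (congrArg (sgn (q * p) • ·) (opMap_ofElement_add Φ _ y z x)).trans (smul_add _ _ _)
  property Φ Ψ s θ q r q' r' h hq hr y := by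
    change sgn (q' * p) • E.opMap n m (DGTrans.ofElement Ψ (θ.app a q q' hq y)) _ x =
      sgn (s * p) • E.opMap n m θ _ (sgn (q * p) • E.opMap n m (DGTrans.ofElement Φ y) _ x)
    rw [opMap_ofElement_app hq θ y _ ((add_comm p q).trans h) (by omega), map_zsmul, smul_smul,
      ← sgn_add, ← add_mul, add_comm s q, hq]

/-- The Yoneda isomorphism between the complexes `Hom(Φ ↦ Φ(a), Φ ↦ C^n(Φ)(m))` and
`C^n(E(a, -))(m)`. -/
def opYoneda (a n m : ℕ) (p : ℤ) : E.opHom 0 a n m p ≃+ E.opX n m (E.rep a) p where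
  __ := opEval a n m p
  invFun := opOfElement
  left_inv ν := Subtype.ext (GrHom.ext fun Φ q r h y =>
    (opHom_apply_eq ν Φ h ((add_comm p q).trans h) y).symm)
  right_inv x := by
    change sgn (0 * p) • E.opMap n m (DGTrans.ofElement (E.rep a) (E.id a)) _ x = x
    rw [zero_mul, sgn_zero, one_smul, opMap_ofElement_id]

lemma opYoneda_opHomD {p q : ℤ} (hq : q + 1 = p) (ν : E.opHom 0 a n m p) :
    opYoneda a n m q (E.opHomD 0 a n m p q ν) =
      E.opD n m (E.rep a) p q (opYoneda a n m p ν) := by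
  let e : E.opX 0 a (E.rep a) 0 := E.id a
  have hd : E.opD 0 a (E.rep a) 0 (-1) e = 0 := DGProp.d_id a (neg_add_cancel 1)
  change (E.opHomD 0 a n m p q ν).1 (E.rep a) 0 q (zero_add q) e = _
  rw [opHomD_coe E hq, GrHom.diff_apply _ _ hq _ _ _ (p' := -1) (q' := p) (neg_add_cancel 1) hq,
    hd, map_zero, sub_zero, sgn_zero, one_smul]
  rfl

namespace Hom

variable {E' : AinfProp.{u}} (φ : Hom E E')

lemma opYoneda_opRestrict {p : ℤ} (ν : E.opHom 0 a n m p) :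
    opYoneda a n m p (φ.opRestrict 0 a n m p ν) =
      E.opMap n m (φ.repTrans a) (add_zero p) (opYoneda a n m p ν) := by
  refine (opHom_apply_eq ν ((E'.rep a).pullback φ.toFunctor) (zero_add p) (add_zero p)
    (E'.id a)).trans ?_
  rw [zero_mul, sgn_zero, one_smul]
  rfl

lemma diff_repTrans (a : ℕ) :
    GrHom.diff (E.rep a).str.d ((E'.rep a).pullback φ.toFunctor).str.d (neg_add_cancel 1)
      (φ.repTrans a).app = 0 := by
  have hd : ((E'.rep a).pullback φ.toFunctor).str.d a 0 (-1) (E'.id a) = 0 :=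
    DGProp.d_id a (neg_add_cancel 1)
  refine (DGTrans.diff_ofElement _ _ _).trans ?_
  rw [hd, DGTrans.ofElement_app_zero]

lemma coneExact_repTrans (hφ : φ.toFunctor.IsQuasiIso) (a b : ℕ) :
    ConeExact ((E.rep a).str.d b) ((E'.rep a).str.d b)
      fun p => (φ.repTrans a).app b p p (add_zero p) := by
  have h_app : (fun p => (φ.repTrans a).app b p p (add_zero p)) =
      fun p => ((φ.map a b).f p).hom :=
    funext fun p => AddMonoidHom.ext fun f => φ.repTrans_app a b f
  rw [h_app]
  exact (quasiIso_iff_coneExact _).1 (hφ a b)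

lemma coneExact_opRestrict_zero (hφ : φ.toFunctor.IsQuasiIso) (a n m : ℕ) :
    ConeExact (E.opHomD 0 a n m) (E'.opHomD 0 a n m) (φ.opRestrict 0 a n m) := by
  have h : ConeExact (E.opD n m (E.rep a)) (E'.opD n m (E'.rep a))
      fun p => E.opMap n m (φ.repTrans a) (add_zero p) := by
    rw [← φ.opD_pullback]
    exact coneExact_hochIterMap (E.rep a).str ((E'.rep a).pullback φ.toFunctor).str
      (φ.repTrans a).naturality (φ.diff_repTrans a) (φ.coneExact_repTrans hφ a) n m
  exact h.of_addEquiv (opYoneda a n m) (opYoneda a n m) (fun _ _ => opYoneda_opHomD)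
    (fun _ _ => opYoneda_opHomD) fun _ => φ.opYoneda_opRestrict

end Hom

end Yoneda

section Slices

variable {E : AinfProp.{u}}

/-- The inclusion `x ↦ x ⊗ l_{j+1}` of `C^n(Φ)(j + 1 + m)` in `C^{n+1}(Φ)(m)`. -/
def opInc (n m : ℕ) (Φ : DGFunctor E.toDGCat) (j : ℕ) {p' p : ℤ} (h : p' + j = p) :
    E.opX n (j + 1 + m) Φ p' →+ E.opX (n + 1) m Φ p :=
  hochInc (X := hochIterX n Φ.X) j h

/-- The homomorphism out of `C^{n+1}(Φ)(m)` with given values on the summands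
`C^n(Φ)(j + 1 + m)`. -/
def opDesc (n m : ℕ) (Φ : DGFunctor E.toDGCat) {p : ℤ} {B : Type*} [AddCommGroup B]
    (F : ∀ (j : ℕ) (p' : ℤ), p' + j = p → (E.opX n (j + 1 + m) Φ p' →+ B)) :
    E.opX (n + 1) m Φ p →+ B :=
  hochDesc (X := hochIterX n Φ.X) F

lemma opDesc_opInc {n m : ℕ} {Φ : DGFunctor E.toDGCat} {p : ℤ} {B : Type*} [AddCommGroup B]
    (F : ∀ (j : ℕ) (p' : ℤ), p' + j = p → (E.opX n (j + 1 + m) Φ p' →+ B)) (j : ℕ) {p' : ℤ}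
    (h : p' + j = p) (x : E.opX n (j + 1 + m) Φ p') :
    opDesc n m Φ F (opInc n m Φ j h x) = F j p' h x :=
  hochDesc_inc (X := hochIterX n Φ.X) F j h x

lemma op_hom_ext {n m : ℕ} {Φ : DGFunctor E.toDGCat} {p : ℤ} {B : Type*} [AddCommGroup B]
    {f g : E.opX (n + 1) m Φ p →+ B}
    (h : ∀ (j : ℕ) (p' : ℤ) (hp : p' + j = p) (x : E.opX n (j + 1 + m) Φ p'),
      f (opInc n m Φ j hp x) = g (opInc n m Φ j hp x)) : f = g :=
  hoch_hom_ext (X := hochIterX n Φ.X) h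

lemma opMap_opInc (n m : ℕ) {Φ Ψ : DGFunctor E.toDGCat} {s : ℤ} (θ : DGTrans Φ Ψ s)
    {p q p' q' : ℤ} (h : p + s = q) (j : ℕ) (hp : p' + j = p) (hq : q' + j = q) (hs : p' + s = q')
    (x : E.opX n (j + 1 + m) Φ p') :
    E.opMap (n + 1) m θ h (opInc n m Φ j hp x) =
      sgn (j * s) • opInc n m Ψ j hq (E.opMap n (j + 1 + m) θ hs x) :=
  hochMap_inc (hochIterMap θ.app n) h j hp hq hs x

lemma exists_opD_opInc (n m : ℕ) (Φ : DGFunctor E.toDGCat) {p q p' q' : ℤ} (hq : q + 1 = p)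
    (j : ℕ) (hp : p' + j = p) (hq' : q' + j = q) (x : E.opX n (j + 1 + m) Φ p') :
    ∃ z : ∀ i : ℕ, E.opX n (i + 1 + m) Φ (q - i),
      E.opD (n + 1) m Φ p q (opInc n m Φ j hp x) =
        opInc n m Φ j hq' (E.opD n (j + 1 + m) Φ p' q' x) +
          sgn p' • ∑ i ∈ Finset.range j, opInc n m Φ i (sub_add_cancel q i) (z i) :=
  ⟨_, hochD_inc (hochIterStr Φ.str n) hq hp hq' x⟩

variable {n m n' m' : ℕ}

/-- The restriction of a natural transformation on `C^{n+1}(-)(m)` to the summand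
`C^n(-)(j + 1 + m)`. -/
def opSummand (j : ℕ) {p : ℤ} :
    E.opHom (n + 1) m n' m' p →+ E.opHom n (j + 1 + m) n' m' (p + j) where
  toFun ν := ⟨fun Φ q r h => (ν.1 Φ (q + j) r (by omega)).comp (opInc n m Φ j rfl), by
    intro Φ Ψ s θ q r q' r' h hq hr x
    have h_inc : opInc n m Ψ j rfl (E.opMap n (j + 1 + m) θ hq x) =
        sgn (j * s) • E.opMap (n + 1) m θ (by omega) (opInc n m Φ j rfl x) := by
      rw [opMap_opInc n m θ _ j rfl rfl hq, smul_smul, sgn_mul_self, one_smul]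
    simp only [AddMonoidHom.comp_apply]
    rw [h_inc, map_zsmul, ν.2 θ (r := r) (by omega), smul_smul, ← sgn_add]
    congr 2
    ring⟩
  map_zero' := rfl
  map_add' _ _ := rfl

/-- The restriction of a natural transformation `ν` on `C^{n+1}(-)(m)` to the summand
`C^n(-)(j + 1 + m)`, with the Koszul sign for exchanging `ν` with the inclusion of degree `j`. The
sign makes the diagonal part of the differential agree with the differentials on the summands. -/
def opSlice (j : ℕ) {p : ℤ} :
    E.opHom (n + 1) m n' m' p →+ E.opHom n (j + 1 + m) n' m' (p + j) :=
  sgn (j * p) • opSummand j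

lemma opSlice_apply (j : ℕ) {p : ℤ} (ν : E.opHom (n + 1) m n' m' p) (Φ : DGFunctor E.toDGCat)
    {q r i : ℤ} (h : q + (p + j) = r) (hi : q + j = i) (hi' : i + p = r)
    (x : E.opX n (j + 1 + m) Φ q) :
    (opSlice j ν).1 Φ q r h x = sgn (j * p) • ν.1 Φ i r hi' (opInc n m Φ j hi x) := by
  subst hi
  rw [opSlice, AddMonoidHom.zsmul_apply, AddSubgroup.coe_zsmul, GrHom.zsmul_apply]
  rfl

lemma apply_opInc (j : ℕ) {p : ℤ} (ν : E.opHom (n + 1) m n' m' p) (Φ : DGFunctor E.toDGCat)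
    {q r i : ℤ} (hi : q + j = i) (h : i + p = r) (h' : q + (p + j) = r)
    (x : E.opX n (j + 1 + m) Φ q) :
    ν.1 Φ i r h (opInc n m Φ j hi x) = sgn (j * p) • (opSlice j ν).1 Φ q r h' x := by
  rw [opSlice_apply j ν Φ h' hi h, smul_smul, sgn_mul_self, one_smul]

/-- The natural transformation on `C^{n+1}(-)(m)` with given signed restrictions `opSlice`. -/
def opGlue {p : ℤ} (F : ∀ j : ℕ, E.opHom n (j + 1 + m) n' m' (p + j)) :
    E.opHom (n + 1) m n' m' p where
  val Φ q r h := opDesc n m Φ fun j p' hp => sgn (j * p) • (F j).1 Φ p' r (by omega)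
  property Φ Ψ s θ q r q' r' h hq hr x := by
    suffices h_comp :
        (opDesc n m Ψ fun j p' hp => sgn (j * p) • (F j).1 Ψ p' r' (by omega)).comp
          (E.opMap (n + 1) m θ hq) = sgn (s * p) • (E.opMap n' m' θ (by omega)).comp
            (opDesc n m Φ fun j p' hp => sgn (j * p) • (F j).1 Φ p' r (by omega)) from
      DFunLike.congr_fun h_comp x
    refine op_hom_ext fun j p' hp x => ?_
    simp only [AddMonoidHom.comp_apply, AddMonoidHom.zsmul_apply]
    rw [opMap_opInc n m θ hq j hp (q' := p' + s) (by omega) rfl, map_zsmul, opDesc_opInc,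
      opDesc_opInc, AddMonoidHom.zsmul_apply, AddMonoidHom.zsmul_apply, map_zsmul,
      (F j).2 θ (r := r) (by omega) rfl, smul_smul, smul_smul, smul_smul, ← sgn_add, ← sgn_add,
      ← sgn_add]
    congr 1
    exact sgn_congr ⟨j * s, by ring⟩

lemma opSlice_opGlue {p : ℤ} (F : ∀ j : ℕ, E.opHom n (j + 1 + m) n' m' (p + j)) (j : ℕ) :
    opSlice j (opGlue F) = F j := by
  refine Subtype.ext (GrHom.ext fun Φ q r h x => ?_)
  rw [opSlice_apply j _ Φ h rfl (by omega)]
  refine (congrArg (sgn (j * p) • ·) (opDesc_opInc _ j rfl x)).trans ?_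
  rw [AddMonoidHom.zsmul_apply, smul_smul, sgn_mul_self, one_smul]

lemma isProductCoord_opSlice (p : ℤ) :
    IsProductCoord fun j =>
      opSlice (E := E) (n := n) (m := m) (n' := n') (m' := m') j (p := p) where
  ext ν hν := by
    refine Subtype.ext (funext fun Φ => funext fun q => funext fun r => funext fun h =>
      op_hom_ext fun j p' hp x => ?_)
    rw [apply_opInc j ν Φ hp h (by omega), hν j]
    exact smul_zero _
  exists_eq F := ⟨opGlue F, opSlice_opGlue F⟩

lemma isTriangular_opHomD {p q : ℤ} (hq : q + 1 = p) :
    IsTriangular (· < ·) (fun j => opSlice j) (fun j => opSlice j) (E.opHomD (n + 1) m n' m' p q)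
      fun j => E.opHomD n (j + 1 + m) n' m' (p + j) (q + j) := by
  intro ν j hν
  have h_low {i : ℕ} (hi : i < j) {Φ : DGFunctor E.toDGCat} {a c b : ℤ} (ha : a + i = c)
      (hb : c + p = b) (z : E.opX n (i + 1 + m) Φ a) : ν.1 Φ c b hb (opInc n m Φ i ha z) = 0 := by
    rw [apply_opInc i ν Φ ha hb (by omega), hν i hi]
    exact smul_zero _
  have h_inc {Φ : DGFunctor E.toDGCat} {a c b : ℤ} (hb : c + p = b) (hc : a + j - 1 = c)
      (x : E.opX n (j + 1 + m) Φ a) :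
      ν.1 Φ c b hb (E.opD (n + 1) m Φ (a + j) c (opInc n m Φ j rfl x)) = sgn (j * p) •
        (opSlice j ν).1 Φ (a - 1) b (by omega) (E.opD n (j + 1 + m) Φ a (a - 1) x) := by
    obtain ⟨z, hz⟩ := exists_opD_opInc n m Φ (p := a + j) (q := c) (by omega) j rfl
      (q' := a - 1) (by omega) x
    rw [hz, map_add, map_zsmul, map_sum,
      Finset.sum_eq_zero fun i hi => h_low (Finset.mem_range.1 hi) _ _ _, smul_zero, add_zero,
      apply_opInc j ν Φ]
  refine Subtype.ext (GrHom.ext fun Φ a b h x => ?_)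
  rw [opSlice_apply j _ Φ h rfl (by omega), opHomD_coe E hq, opHomD_coe E (by omega),
    GrHom.diff_apply _ _ hq _ _ _ (p' := a + j - 1) (q' := b + 1) (by omega) rfl,
    GrHom.diff_apply _ _ _ _ _ h (p' := a - 1) (q' := b + 1) (by omega) rfl,
    h_inc _ rfl, apply_opInc j ν Φ rfl _ (by omega),
    map_zsmul, ← smul_sub, smul_smul, smul_smul, ← sgn_add, ← sgn_add]
  congr 1
  exact sgn_congr ⟨j * p, by rw [← hq]; ring⟩

lemma opHomD_opHomD {p q r : ℤ} (ν : E.opHom n m n' m' p) :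
    E.opHomD n m n' m' q r (E.opHomD n m n' m' p q ν) = 0 :=
  ConcreteCategory.congr_hom ((E.formalOps.hom (n, m) (n', m')).d_comp_d p q r) ν

namespace Hom

variable {E' : AinfProp.{u}} (φ : Hom E E')

lemma isTriangular_opRestrict (p : ℤ) :
    IsTriangular (· < ·) (fun j => opSlice j) (fun j => opSlice j)
      (φ.opRestrict (n + 1) m n' m' p) fun j => φ.opRestrict n (j + 1 + m) n' m' (p + j) :=
  fun ν j _ => by
    simp only [opSlice, AddMonoidHom.zsmul_apply, map_zsmul]
    rfl

lemma coneExact_opRestrict_succ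
    (hc : ∀ j, ConeExact (E.opHomD n (j + 1 + m) n' m') (E'.opHomD n (j + 1 + m) n' m')
      (φ.opRestrict n (j + 1 + m) n' m')) :
    ConeExact (E.opHomD (n + 1) m n' m') (E'.opHomD (n + 1) m n' m')
      (φ.opRestrict (n + 1) m n' m') :=
  coneExact_of_isProductCoord isProductCoord_opSlice isProductCoord_opSlice
    (fun _ _ => isTriangular_opHomD) (fun _ _ => isTriangular_opHomD) φ.isTriangular_opRestrict
    (fun _ _ _ => opHomD_opHomD) (fun _ _ _ => opHomD_opHomD)
    (fun _ _ hq ν => (φ.opHomD_opRestrict hq ν).symm)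
    fun j _ _ _ _ hq hr hs => hc j (by omega) (by omega) (by omega)

lemma coneExact_opRestrict (hφ : φ.toFunctor.IsQuasiIso) (n' m' : ℕ) :
    ∀ n m, ConeExact (E.opHomD n m n' m') (E'.opHomD n m n' m') (φ.opRestrict n m n' m')
  | 0, m => φ.coneExact_opRestrict_zero hφ m n' m'
  | n + 1, m => φ.coneExact_opRestrict_succ fun j => coneExact_opRestrict hφ n' m' n (j + 1 + m)

end Hom

end Slices

end AinfProp

theorem corollary2 (E E' : AinfProp.{u}) (φ : AinfProp.Hom E E')
    (hφ : φ.toFunctor.IsQuasiIso) : φ.mapFormalOps.IsQuasiIso := fun a b =>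
  (quasiIso_iff_coneExact _).2 (φ.coneExact_opRestrict hφ b.1 b.2 a.1 a.2)
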